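/- A (left) skew brace is a triple $(A,+,\circ)$ in which $(A,+)$ and $(A,\circ)$ are groups and $a\circ(b+c)=a\circ b-a+a\circ c$ for all $a,b,c\in A$. Then $(A,\circ)$ acts on $(A,+)$ by automorphisms via $\lambda_a(x)=-a+a\circ x$. For finite $A$, the $\lambda$-graph $\Lambda(A)$ has as vertices the $\lambda$-orbits of size greater than $1$, two different orbits being adjacent when their sizes are not coprime. For an abelian group $G$ of odd order $d$ and an integer $i\ge 1$ define the following skew braces, where $k,k_1,k_2\in\mathbb Z/2\mathbb Z$, and where in a component in $\mathbb Z/2^i\mathbb Z$ the product $k_1k_2$ is read as the integer $0$ or $1$. $D_{2d}(G)$, on $G\times\mathbb Z/2\mathbb Z$: $$(g_1,k_1)+(g_2,k_2)=(g_1+(-1)^{k_1}g_2,\;k_1+k_2),\qquad (g_1,k_1)\circ(g_2,k_2)=((-1)^{k_2}g_1+(-1)^{k_1}g_2,\;k_1+k_2).$$ $J_{2^{i+1}d}(G)$, on $\mathbb Z/2^i\mathbb Z\times G\times\mathbb Z/2\mathbb Z$: $$(a_1,g_1,k_1)+(a_2,g_2,k_2)=(a_1+(-1)^{k_1}a_2,\;g_1+(-1)^{k_1}g_2,\;k_1+k_2),$$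 $$(a_1,g_1,k_1)\circ(a_2,g_2,k_2)=((-1)^{k_2}a_1+(-1)^{k_1}a_2-k_1k_2,\;(-1)^{k_2}g_1+(-1)^{k_1}g_2,\;k_1+k_2).$$ $H_{2^{i+1}d}(G)$, on $\mathbb Z/2^i\mathbb Z\times G\times\mathbb Z/2\mathbb Z$: $$(a_1,g_1,k_1)+(a_2,g_2,k_2)=(a_1+(-1)^{k_1}a_2+2^{i-1}k_1k_2,\;g_1+(-1)^{k_1}g_2,\;k_1+k_2),$$ $$(a_1,g_1,k_1)\circ(a_2,g_2,k_2)=((-1)^{k_2}a_1+(-1)^{k_1}a_2-k_1k_2+2^{i-1}k_1k_2,\;(-1)^{k_2}g_1+(-1)^{k_1}g_2,\;k_1+k_2).$$ $K_{8d}(G)$, on $\mathbb Z/2\mathbb Z\times\mathbb Z/2\mathbb Z\times G\times\mathbb Z/2\mathbb Z$: $$(a_1,b_1,g_1,k_1)+(a_2,b_2,g_2,k_2)=(a_1+a_2,\;b_1+b_2+k_1k_2,\;g_1+(-1)^{k_1}g_2,\;k_1+k_2),$$ $$(a_1,b_1,g_1,k_1)\circ(a_2,b_2,g_2,k_2)=(a_1+a_2+k_2b_1,\;b_1+b_2,\;(-1)^{k_2}g_1+(-1)^{k_1}g_2,\;k_1+k_2).$$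 **Theorem.** Let $m\ge 0$ and let $d\ge 1$ be odd. The following is a complete list, without repetitions up to isomorphism, of the skew braces of size $2^md$ whose $\lambda$-graph has exactly one vertex, where $G$ runs over the abelian groups of order $d$ up to isomorphism: - $m=0$: none; - $m=1$: $D_{2d}(G)$ if $d>1$, and none if $d=1$; - $m=2$: $J_{4d}(G)$ and $H_{4d}(G)$; - $m=3$: $K_{8d}(G)$, $J_{8d}(G)$ and $H_{8d}(G)$; - $m\ge 4$: $J_{2^md}(G)$ and $H_{2^md}(G)$. That is, every listed skew brace has size $2^md$ and a one-vertex $\lambda$-graph; every skew brace of size $2^md$ with a one-vertex $\lambda$-graph is isomorphic to a listed one; members of the same family are isomorphic if and only if the groups $G$ are; and members of different families of the same size are not isomorphic. Consequently, if $\operatorname{a}(d)$ is the number of isomorphism classes of abelian groups of order $d$, the number of isomorphism classes is $0$ for $m=0$; $\operatorname{a}(d)$ for $m=1$ and $d>1$; $0$ for $m=1$ and $d=1$; $2\operatorname{a}(d)$ for $m=2$; $3\operatorname{a}(d)$ for $m=3$; and $2\operatorname{a}(d)$ for $m\ge 4$. -/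

import Mathlib

universe u

/-- A (left) skew brace `(A, +, ∘)`: two group structures on `A`, neither assumed commutative, with
`a ∘ (b + c) = a ∘ b - a + a ∘ c`.  The operation `∘` is written `*`. -/
class SkewBrace (A : Type u) extends AddGroup A, Group A where
  skew_distrib : ∀ a b c : A, a * (b + c) = a * b - a + a * c

/-- An isomorphism of skew braces: a bijection preserving both `+` and `∘` (written `*`). -/
abbrev SkewBraceIso (A B : Type u) [SkewBrace A] [SkewBrace B] : Type u := A ≃+* B

namespace SkewBrace

theorem mul_zero_eq {A : Type u} [SkewBrace A] (a : A) : a * 0 = a := by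
  have h := skew_distrib a 0 0
  rw [add_zero] at h
  have h2 : a * 0 + 0 = a * 0 + (-a + a * 0) := by
    rw [add_zero, ← add_assoc, ← sub_eq_add_neg]; exact h
  have h3 := add_left_cancel h2
  exact (neg_add_eq_zero.mp h3.symm).symm

theorem one_eq_zero {A : Type u} [SkewBrace A] : (1 : A) = 0 := by
  simpa using (mul_zero_eq (1 : A)).symm

/-- The action `λ` of the group `(A, ∘)` on the group `(A, +)` by automorphisms,
`λ_a(x) = -a + a ∘ x`, as a homomorphism into the monoid of endomorphisms of `(A, +)`
(its image consists of automorphisms because `(A, ∘)` is a group). -/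
def lam (A : Type u) [SkewBrace A] : A →* AddMonoid.End A where
  toFun a :=
    { toFun := fun x => -a + a * x
      map_zero' := by rw [mul_zero_eq]; simp
      map_add' := fun x y => by
        rw [skew_distrib, sub_eq_add_neg]; simp only [add_assoc] }
  map_one' := by
    ext x
    change -1 + 1 * x = x
    rw [one_mul, one_eq_zero, neg_zero, zero_add]
  map_mul' a b := by
    ext x
    change -(a * b) + a * b * x = -a + a * (-b + b * x)
    have h0 : a * (-b) = a - a * b + a := by
      have h := skew_distrib a b (-b)
      rw [add_neg_cancel, mul_zero_eq] at h
      have : a * (-b) = -(a * b - a) + a := by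
        rw [eq_neg_add_iff_add_eq]; exact h.symm
      rw [this, neg_sub]
    rw [skew_distrib, h0]
    simp only [sub_eq_add_neg, add_assoc, neg_add_cancel_left, add_neg_cancel_left, mul_assoc]

end SkewBrace

/-! ### The common divisor graph -/

section CommonDivisorGraph

variable {G H : Type u} [Group G] [AddGroup H]

/-- The orbit of `x` under an action `α` of `G` on the group `H` by automorphisms. -/
def actionOrbit (α : G →* AddMonoid.End H) (x : H) : Set H := Set.range fun g => α g x

/-- The non-trivial orbits of `α` (those with more than one element), as a type. -/
def NontrivialOrbit (α : G →* AddMonoid.End H) : Type u :=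
  {L : Set H // (∃ x, L = actionOrbit α x) ∧ 1 < L.ncard}

/-- The common divisor graph: its vertices are the non-trivial orbits, and two different vertices
are adjacent when their sizes are not coprime. -/
def commonDivisorGraph (α : G →* AddMonoid.End H) : SimpleGraph (NontrivialOrbit α) where
  Adj L M := L ≠ M ∧ Nat.gcd L.1.ncard M.1.ncard ≠ 1
  symm := ⟨fun L M h => ⟨h.1.symm, by rw [Nat.gcd_comm]; exact h.2⟩⟩
  loopless := ⟨fun _ h => h.1 rfl⟩

end CommonDivisorGraph

/-- The `λ`-graph of a skew brace. -/
def lambdaGraph (A : Type u) [SkewBrace A] : SimpleGraph (NontrivialOrbit (SkewBrace.lam A)) :=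
  commonDivisorGraph (SkewBrace.lam A)

/-- The graph has exactly one vertex. -/
def SimpleGraph.HasExactlyOneVertex {V : Type u} (_Γ : SimpleGraph V) : Prop :=
  Nat.card V = 1

/-! ### The four families -/

/-- `(-1)^k` for `k ∈ ℤ/2ℤ`. -/
def zsgn (k : ZMod 2) : ℤ := (-1) ^ k.val

theorem zsgn_zero : zsgn 0 = 1 := rfl

theorem zsgn_one : zsgn 1 = -1 := rfl

theorem zmod2_cases (k : ZMod 2) : k = 0 ∨ k = 1 := by
  revert k; decide

theorem zmod2_one_add_one : (1 : ZMod 2) + 1 = 0 := rfl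

theorem zmod2_val_one : (1 : ZMod 2).val = 1 := rfl

/-- The underlying set `G × ℤ/2ℤ` of `D_{2d}(G)`, where `d = |G|`. -/
@[ext] structure DBrace (G : Type u) : Type u where
  g : G
  k : ZMod 2

/-- The underlying set `ℤ/2^iℤ × G × ℤ/2ℤ` of `J_{2^(i+1)d}(G)`, where `d = |G|`. -/
@[ext] structure JBrace (i : ℕ) (G : Type u) : Type u where
  a : ZMod (2 ^ i)
  g : G
  k : ZMod 2

/-- The underlying set `ℤ/2^iℤ × G × ℤ/2ℤ` of `H_{2^(i+1)d}(G)`, where `d = |G|`. -/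
@[ext] structure HBrace (i : ℕ) (G : Type u) : Type u where
  a : ZMod (2 ^ i)
  g : G
  k : ZMod 2

/-- The underlying set `ℤ/2ℤ × ℤ/2ℤ × G × ℤ/2ℤ` of `K_{8d}(G)`, where `d = |G|`. -/
@[ext] structure KBrace (G : Type u) : Type u where
  a : ZMod 2
  b : ZMod 2
  g : G
  k : ZMod 2

section Families

variable {G : Type u} [AddCommGroup G]

namespace DBrace

instance : Add (DBrace G) := ⟨fun x y => ⟨x.g + zsgn x.k • y.g, x.k + y.k⟩⟩

instance : Mul (DBrace G) := ⟨fun x y => ⟨zsgn y.k • x.g + zsgn x.k • y.g, x.k + y.k⟩⟩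

instance : Zero (DBrace G) := ⟨⟨0, 0⟩⟩

instance : One (DBrace G) := ⟨⟨0, 0⟩⟩

instance : Neg (DBrace G) := ⟨fun x => ⟨-(zsgn x.k • x.g), x.k⟩⟩

instance : Inv (DBrace G) := ⟨fun x => ⟨-x.g, x.k⟩⟩

theorem add_def (x y : DBrace G) : x + y = ⟨x.g + zsgn x.k • y.g, x.k + y.k⟩ := rfl

theorem mul_def (x y : DBrace G) : x * y = ⟨zsgn y.k • x.g + zsgn x.k • y.g, x.k + y.k⟩ := rfl

theorem zero_def : (0 : DBrace G) = ⟨0, 0⟩ := rfl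

theorem one_def : (1 : DBrace G) = ⟨0, 0⟩ := rfl

theorem neg_def (x : DBrace G) : -x = ⟨-(zsgn x.k • x.g), x.k⟩ := rfl

theorem inv_def (x : DBrace G) : x⁻¹ = ⟨-x.g, x.k⟩ := rfl

instance : AddGroup (DBrace G) := AddGroup.ofLeftAxioms
  (by
    rintro ⟨g, k⟩ ⟨g', k'⟩ ⟨g'', k''⟩
    rcases zmod2_cases k with rfl | rfl <;> rcases zmod2_cases k' with rfl | rfl <;>
      simp [add_def, zsgn_zero, zsgn_one, zmod2_one_add_one, ← add_assoc])
  (by rintro ⟨g, k⟩; simp [add_def, zero_def, zsgn_zero])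
  (by
    rintro ⟨g, k⟩
    rcases zmod2_cases k with rfl | rfl <;>
      simp [add_def, neg_def, zero_def, zsgn_zero, zsgn_one, zmod2_one_add_one])

instance : Group (DBrace G) := Group.ofLeftAxioms
  (by
    rintro ⟨g, k⟩ ⟨g', k'⟩ ⟨g'', k''⟩
    rcases zmod2_cases k with rfl | rfl <;> rcases zmod2_cases k' with rfl | rfl <;>
      rcases zmod2_cases k'' with rfl | rfl <;>
      simp [mul_def, zsgn_zero, zsgn_one, zmod2_one_add_one] <;> abel)
  (by rintro ⟨g, k⟩; simp [mul_def, one_def, zsgn_zero])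
  (by
    rintro ⟨g, k⟩
    rcases zmod2_cases k with rfl | rfl <;>
      simp [mul_def, inv_def, one_def, zsgn_zero, zsgn_one, zmod2_one_add_one])

/-- The skew brace `D_{2d}(G)`. -/
instance : SkewBrace (DBrace G) where
  __ := (inferInstance : AddGroup (DBrace G))
  __ := (inferInstance : Group (DBrace G))
  skew_distrib := by
    rintro ⟨g, k⟩ ⟨g', k'⟩ ⟨g'', k''⟩
    rcases zmod2_cases k with rfl | rfl <;> rcases zmod2_cases k' with rfl | rfl <;>
      rcases zmod2_cases k'' with rfl | rfl <;>
      simp [sub_eq_add_neg, neg_def, mul_def, add_def, zsgn_zero, zsgn_one,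
        zmod2_one_add_one] <;> abel

end DBrace

namespace JBrace

variable {i : ℕ}

instance : Add (JBrace i G) :=
  ⟨fun x y => ⟨x.a + zsgn x.k • y.a, x.g + zsgn x.k • y.g, x.k + y.k⟩⟩

/-- The term `(x.k * y.k).val`, which is `0` or `1`, is `(1 - (-1)^(k₁k₂)) / 2`. -/
instance : Mul (JBrace i G) :=
  ⟨fun x y => ⟨zsgn y.k • x.a + zsgn x.k • y.a - ((x.k * y.k).val : ZMod (2 ^ i)),
    zsgn y.k • x.g + zsgn x.k • y.g, x.k + y.k⟩⟩

instance : Zero (JBrace i G) := ⟨⟨0, 0, 0⟩⟩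

instance : One (JBrace i G) := ⟨⟨0, 0, 0⟩⟩

instance : Neg (JBrace i G) := ⟨fun x => ⟨-(zsgn x.k • x.a), -(zsgn x.k • x.g), x.k⟩⟩

instance : Inv (JBrace i G) := ⟨fun x => ⟨-x.a - (x.k.val : ZMod (2 ^ i)), -x.g, x.k⟩⟩

theorem add_def (x y : JBrace i G) :
    x + y = ⟨x.a + zsgn x.k • y.a, x.g + zsgn x.k • y.g, x.k + y.k⟩ := rfl

theorem mul_def (x y : JBrace i G) :
    x * y = ⟨zsgn y.k • x.a + zsgn x.k • y.a - ((x.k * y.k).val : ZMod (2 ^ i)),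
      zsgn y.k • x.g + zsgn x.k • y.g, x.k + y.k⟩ := rfl

theorem zero_def : (0 : JBrace i G) = ⟨0, 0, 0⟩ := rfl

theorem one_def : (1 : JBrace i G) = ⟨0, 0, 0⟩ := rfl

theorem neg_def (x : JBrace i G) :
    -x = ⟨-(zsgn x.k • x.a), -(zsgn x.k • x.g), x.k⟩ := rfl

theorem inv_def (x : JBrace i G) :
    x⁻¹ = ⟨-x.a - (x.k.val : ZMod (2 ^ i)), -x.g, x.k⟩ := rfl

instance : AddGroup (JBrace i G) := AddGroup.ofLeftAxioms
  (by
    rintro ⟨a, g, k⟩ ⟨a', g', k'⟩ ⟨a'', g'', k''⟩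
    rcases zmod2_cases k with rfl | rfl <;> rcases zmod2_cases k' with rfl | rfl <;>
      simp [add_def, zsgn_zero, zsgn_one, zmod2_one_add_one, ← add_assoc])
  (by rintro ⟨a, g, k⟩; simp [add_def, zero_def, zsgn_zero])
  (by
    rintro ⟨a, g, k⟩
    rcases zmod2_cases k with rfl | rfl <;>
      simp [add_def, neg_def, zero_def, zsgn_zero, zsgn_one, zmod2_one_add_one])

instance : Group (JBrace i G) := Group.ofLeftAxioms
  (by
    rintro ⟨a, g, k⟩ ⟨a', g', k'⟩ ⟨a'', g'', k''⟩
    rcases zmod2_cases k with rfl | rfl <;> rcases zmod2_cases k' with rfl | rfl <;>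
      rcases zmod2_cases k'' with rfl | rfl <;>
      simp [mul_def, zsgn_zero, zsgn_one, zmod2_one_add_one, zmod2_val_one] <;>
      constructor <;> abel)
  (by rintro ⟨a, g, k⟩; simp [mul_def, one_def, zsgn_zero])
  (by
    rintro ⟨a, g, k⟩
    rcases zmod2_cases k with rfl | rfl <;>
      simp [mul_def, inv_def, one_def, zsgn_zero, zsgn_one, zmod2_one_add_one, zmod2_val_one])

/-- The skew brace `J_{2^(i+1)d}(G)`. -/
instance : SkewBrace (JBrace i G) where
  __ := (inferInstance : AddGroup (JBrace i G))
  __ := (inferInstance : Group (JBrace i G))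
  skew_distrib := by
    rintro ⟨a, g, k⟩ ⟨a', g', k'⟩ ⟨a'', g'', k''⟩
    rcases zmod2_cases k with rfl | rfl <;> rcases zmod2_cases k' with rfl | rfl <;>
      rcases zmod2_cases k'' with rfl | rfl <;>
      simp [sub_eq_add_neg, neg_def, mul_def, add_def, zsgn_zero, zsgn_one,
        zmod2_one_add_one, zmod2_val_one] <;> constructor <;> abel

end JBrace

namespace HBrace

variable {i : ℕ}

/-- The element `2^(i-1) k₁ k₂` of `ℤ/2^iℤ` (for `i ≥ 1`). -/
def cocycle (i : ℕ) (k₁ k₂ : ZMod 2) : ZMod (2 ^ i) := 2 ^ (i - 1) * ((k₁ * k₂).val : ZMod (2 ^ i))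

instance : Add (HBrace i G) :=
  ⟨fun x y => ⟨x.a + zsgn x.k • y.a + cocycle i x.k y.k, x.g + zsgn x.k • y.g, x.k + y.k⟩⟩

/-- The term `(x.k * y.k).val`, which is `0` or `1`, is `(1 - (-1)^(k₁k₂)) / 2`. -/
instance : Mul (HBrace i G) :=
  ⟨fun x y => ⟨zsgn y.k • x.a + zsgn x.k • y.a - ((x.k * y.k).val : ZMod (2 ^ i))
      + cocycle i x.k y.k,
    zsgn y.k • x.g + zsgn x.k • y.g, x.k + y.k⟩⟩

instance : Zero (HBrace i G) := ⟨⟨0, 0, 0⟩⟩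

instance : One (HBrace i G) := ⟨⟨0, 0, 0⟩⟩

instance : Neg (HBrace i G) :=
  ⟨fun x => ⟨-(zsgn x.k • x.a) + cocycle i x.k x.k, -(zsgn x.k • x.g), x.k⟩⟩

instance : Inv (HBrace i G) :=
  ⟨fun x => ⟨-x.a - (x.k.val : ZMod (2 ^ i)) + cocycle i x.k x.k, -x.g, x.k⟩⟩

theorem add_def (x y : HBrace i G) :
    x + y = ⟨x.a + zsgn x.k • y.a + cocycle i x.k y.k, x.g + zsgn x.k • y.g, x.k + y.k⟩ := rfl

theorem mul_def (x y : HBrace i G) :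
    x * y = ⟨zsgn y.k • x.a + zsgn x.k • y.a - ((x.k * y.k).val : ZMod (2 ^ i))
      + cocycle i x.k y.k,
      zsgn y.k • x.g + zsgn x.k • y.g, x.k + y.k⟩ := rfl

theorem zero_def : (0 : HBrace i G) = ⟨0, 0, 0⟩ := rfl

theorem one_def : (1 : HBrace i G) = ⟨0, 0, 0⟩ := rfl

theorem neg_def (x : HBrace i G) :
    -x = ⟨-(zsgn x.k • x.a) + cocycle i x.k x.k, -(zsgn x.k • x.g), x.k⟩ := rfl

theorem inv_def (x : HBrace i G) :
    x⁻¹ = ⟨-x.a - (x.k.val : ZMod (2 ^ i)) + cocycle i x.k x.k, -x.g, x.k⟩ := rfl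

theorem cocycle_zero_left (k : ZMod 2) : cocycle i 0 k = 0 := by simp [cocycle]

theorem cocycle_zero_right (k : ZMod 2) : cocycle i k 0 = 0 := by simp [cocycle]

theorem neg_cocycle (k₁ k₂ : ZMod 2) : -cocycle i k₁ k₂ = cocycle i k₁ k₂ := by
  have h : (2 : ZMod (2 ^ i)) ^ (i - 1) + 2 ^ (i - 1) = 0 := by
    rcases i with _ | i
    · exact Subsingleton.elim (α := ZMod 1) _ _
    · rw [Nat.add_sub_cancel, ← two_mul, ← pow_succ']
      exact_mod_cast ZMod.natCast_self (2 ^ (i + 1))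
  rw [neg_eq_iff_add_eq_zero, cocycle, ← add_mul, h, zero_mul]

theorem cocycle_add_self (k₁ k₂ : ZMod 2) : cocycle i k₁ k₂ + cocycle i k₁ k₂ = 0 := by
  rw [← neg_eq_iff_add_eq_zero, neg_cocycle]

instance : AddGroup (HBrace i G) := AddGroup.ofLeftAxioms
  (by
    rintro ⟨a, g, k⟩ ⟨a', g', k'⟩ ⟨a'', g'', k''⟩
    rcases zmod2_cases k with rfl | rfl <;> rcases zmod2_cases k' with rfl | rfl <;>
      rcases zmod2_cases k'' with rfl | rfl <;>
      simp [add_def, zsgn_zero, zsgn_one, zmod2_one_add_one, cocycle_zero_left,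
        cocycle_zero_right, neg_cocycle] <;>
      constructor <;> abel)
  (by rintro ⟨a, g, k⟩; simp [add_def, zero_def, zsgn_zero, cocycle_zero_left])
  (by
    rintro ⟨a, g, k⟩
    rcases zmod2_cases k with rfl | rfl <;>
      simp [add_def, neg_def, zero_def, zsgn_zero, zsgn_one, zmod2_one_add_one,
        cocycle_zero_left]
    exact cocycle_add_self 1 1)

instance : Group (HBrace i G) := Group.ofLeftAxioms
  (by
    rintro ⟨a, g, k⟩ ⟨a', g', k'⟩ ⟨a'', g'', k''⟩
    rcases zmod2_cases k with rfl | rfl <;> rcases zmod2_cases k' with rfl | rfl <;>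
      rcases zmod2_cases k'' with rfl | rfl <;>
      simp [mul_def, zsgn_zero, zsgn_one, zmod2_one_add_one, zmod2_val_one, cocycle_zero_left,
        cocycle_zero_right, neg_cocycle] <;>
      constructor <;> abel1)
  (by rintro ⟨a, g, k⟩; simp [mul_def, one_def, zsgn_zero, cocycle_zero_left])
  (by
    rintro ⟨a, g, k⟩
    rcases zmod2_cases k with rfl | rfl <;>
      simp [mul_def, inv_def, one_def, zsgn_zero, zsgn_one, zmod2_one_add_one, zmod2_val_one,
        cocycle_zero_left, neg_cocycle]
    linear_combination cocycle_add_self (i := i) 1 1)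

/-- The skew brace `H_{2^(i+1)d}(G)`. -/
instance : SkewBrace (HBrace i G) where
  __ := (inferInstance : AddGroup (HBrace i G))
  __ := (inferInstance : Group (HBrace i G))
  skew_distrib := by
    rintro ⟨a, g, k⟩ ⟨a', g', k'⟩ ⟨a'', g'', k''⟩
    rcases zmod2_cases k with rfl | rfl <;> rcases zmod2_cases k' with rfl | rfl <;>
      rcases zmod2_cases k'' with rfl | rfl <;>
      simp [sub_eq_add_neg, neg_def, mul_def, add_def, zsgn_zero, zsgn_one,
        zmod2_one_add_one, zmod2_val_one, cocycle_zero_left, cocycle_zero_right, neg_cocycle] <;>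
      constructor <;> first
        | abel1
        | linear_combination cocycle_add_self (i := i) 1 1
        | linear_combination -cocycle_add_self (i := i) 1 1

end HBrace

namespace KBrace

instance : Add (KBrace G) :=
  ⟨fun x y => ⟨x.a + y.a, x.b + y.b + x.k * y.k, x.g + zsgn x.k • y.g, x.k + y.k⟩⟩

instance : Mul (KBrace G) :=
  ⟨fun x y => ⟨x.a + y.a + y.k * x.b, x.b + y.b, zsgn y.k • x.g + zsgn x.k • y.g, x.k + y.k⟩⟩

instance : Zero (KBrace G) := ⟨⟨0, 0, 0, 0⟩⟩

instance : One (KBrace G) := ⟨⟨0, 0, 0, 0⟩⟩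

instance : Neg (KBrace G) := ⟨fun x => ⟨x.a, x.b + x.k, -(zsgn x.k • x.g), x.k⟩⟩

instance : Inv (KBrace G) := ⟨fun x => ⟨x.a + x.k * x.b, x.b, -x.g, x.k⟩⟩

theorem add_def (x y : KBrace G) :
    x + y = ⟨x.a + y.a, x.b + y.b + x.k * y.k, x.g + zsgn x.k • y.g, x.k + y.k⟩ := rfl

theorem mul_def (x y : KBrace G) :
    x * y = ⟨x.a + y.a + y.k * x.b, x.b + y.b, zsgn y.k • x.g + zsgn x.k • y.g, x.k + y.k⟩ := rfl

theorem zero_def : (0 : KBrace G) = ⟨0, 0, 0, 0⟩ := rfl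

theorem one_def : (1 : KBrace G) = ⟨0, 0, 0, 0⟩ := rfl

theorem neg_def (x : KBrace G) : -x = ⟨x.a, x.b + x.k, -(zsgn x.k • x.g), x.k⟩ := rfl

theorem inv_def (x : KBrace G) : x⁻¹ = ⟨x.a + x.k * x.b, x.b, -x.g, x.k⟩ := rfl

instance : AddGroup (KBrace G) := AddGroup.ofLeftAxioms
  (by
    rintro ⟨a, b, g, k⟩ ⟨a', b', g', k'⟩ ⟨a'', b'', g'', k''⟩
    rw [add_def, add_def, add_def, add_def, KBrace.ext_iff]
    refine ⟨add_assoc _ _ _, by ring, ?_, add_assoc _ _ _⟩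
    rcases zmod2_cases k with rfl | rfl <;> rcases zmod2_cases k' with rfl | rfl <;>
      simp [zsgn_zero, zsgn_one, zmod2_one_add_one] <;> abel)
  (by rintro ⟨a, b, g, k⟩; simp [add_def, zero_def, zsgn_zero])
  (by
    rintro ⟨a, b, g, k⟩
    rw [add_def, KBrace.ext_iff]
    simp only [neg_def, zero_def]
    refine ⟨?_, ?_, ?_, ?_⟩
    · revert a; decide
    · revert b k; decide
    · rcases zmod2_cases k with rfl | rfl <;> simp [zsgn_zero, zsgn_one]
    · revert k; decide)

instance : Group (KBrace G) := Group.ofLeftAxioms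
  (by
    rintro ⟨a, b, g, k⟩ ⟨a', b', g', k'⟩ ⟨a'', b'', g'', k''⟩
    rw [mul_def, mul_def, mul_def, mul_def, KBrace.ext_iff]
    refine ⟨by ring, add_assoc _ _ _, ?_, add_assoc _ _ _⟩
    rcases zmod2_cases k with rfl | rfl <;> rcases zmod2_cases k' with rfl | rfl <;>
      rcases zmod2_cases k'' with rfl | rfl <;>
      simp [zsgn_zero, zsgn_one, zmod2_one_add_one] <;> abel)
  (by rintro ⟨a, b, g, k⟩; simp [mul_def, one_def, zsgn_zero])
  (by
    rintro ⟨a, b, g, k⟩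
    rw [mul_def, KBrace.ext_iff]
    simp only [inv_def, one_def]
    refine ⟨?_, ?_, ?_, ?_⟩
    · revert a b k; decide
    · revert b; decide
    · rcases zmod2_cases k with rfl | rfl <;> simp [zsgn_zero, zsgn_one]
    · revert k; decide)

/-- The skew brace `K_{8d}(G)`. -/
instance : SkewBrace (KBrace G) where
  __ := (inferInstance : AddGroup (KBrace G))
  __ := (inferInstance : Group (KBrace G))
  skew_distrib := by
    rintro ⟨a, b, g, k⟩ ⟨a', b', g', k'⟩ ⟨a'', b'', g'', k''⟩
    rw [sub_eq_add_neg, KBrace.ext_iff]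
    simp only [neg_def, mul_def, add_def]
    refine ⟨?_, ?_, ?_, ?_⟩
    · revert a a' a'' b k' k''; decide
    · revert b b' b'' k k' k''; decide
    · rcases zmod2_cases k with rfl | rfl <;> rcases zmod2_cases k' with rfl | rfl <;>
        rcases zmod2_cases k'' with rfl | rfl <;>
        simp [zsgn_zero, zsgn_one, zmod2_one_add_one] <;> abel
    · revert k k' k''; decide

end KBrace

end Families

/-! ### Numbers of isomorphism classes -/

/-- An abelian group of order `d`. -/
structure AbelianGroupOfOrder (d : ℕ) : Type (u + 1) where
  carrier : Type u
  [group : AddCommGroup carrier]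
  card_eq : Nat.card carrier = d

attribute [instance] AbelianGroupOfOrder.group

/-- Isomorphism of abelian groups of order `d`. -/
def AbelianGroupOfOrder.isoSetoid (d : ℕ) : Setoid (AbelianGroupOfOrder.{u} d) where
  r G G' := Nonempty (G.carrier ≃+ G'.carrier)
  iseqv := ⟨fun _ => ⟨AddEquiv.refl _⟩, fun ⟨e⟩ => ⟨e.symm⟩, fun ⟨e⟩ ⟨f⟩ => ⟨e.trans f⟩⟩

/-- The number `a(d)` of isomorphism classes of abelian groups of order `d`. -/
noncomputable def numAbelianGroups (d : ℕ) : ℕ :=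
  Nat.card (Quotient (AbelianGroupOfOrder.isoSetoid.{u} d))

/-- A skew brace of size `n` whose `λ`-graph has exactly one vertex. -/
structure OneVertexSkewBrace (n : ℕ) : Type (u + 1) where
  carrier : Type u
  [skewBrace : SkewBrace carrier]
  [finite : Finite carrier]
  card_eq : Nat.card carrier = n
  oneVertex : (lambdaGraph carrier).HasExactlyOneVertex

attribute [instance] OneVertexSkewBrace.skewBrace OneVertexSkewBrace.finite

/-- Isomorphism of skew braces of size `n` with one-vertex `λ`-graph. -/
def OneVertexSkewBrace.isoSetoid (n : ℕ) : Setoid (OneVertexSkewBrace.{u} n) where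
  r A B := Nonempty (SkewBraceIso A.carrier B.carrier)
  iseqv := ⟨fun _ => ⟨RingEquiv.refl _⟩, fun ⟨e⟩ => ⟨e.symm⟩, fun ⟨e⟩ ⟨f⟩ => ⟨e.trans f⟩⟩

/-- The number of isomorphism classes of skew braces of size `n` whose `λ`-graph has exactly one
vertex. -/
noncomputable def numOneVertexSkewBraces (n : ℕ) : ℕ :=
  Nat.card (Quotient (OneVertexSkewBrace.isoSetoid.{u} n))

/-!
Let `F` be the subgroup of elements fixed by all `λ_a`. If there is exactly one nontrivial orbit, it
is the complement of `F`; its size divides `|A|`, so `F` has index two. Fix `t ∉ F`. Every `x + t`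
with `x ∈ F` is some `λ_a(t)`, hence `2 (x + t) = λ_a(2 t) = 2 t`, which means that `t` inverts `F`
and that `F` is abelian. Thus `A` is determined by `F`, `z = 2 t`, the displacements
`φ x = λ_x(t) - t` for `x ∈ F`, and `c = λ_t(t) - t`. Multiplicativity of `λ` gives `φ² = -2 φ` and
`φ (z - c) = 2 c`, and transitivity gives `F = φ F ∪ (c + φ F)`; together these force
`φ = -2` as soon as `φ z = 0`.

Split `F = P × G` into its `2`-part and its odd part. On `G` we get `φ = -2` and `z = 0`, and
replacing `t` by a translate makes `c = 0`. On `P` there are two cases. If `φ z = 0`, then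
`P = ⟨c⟩ + 2 P` is cyclic with generator `c`, and `z` is one of the two solutions of `2 z = 0`:
these are the families `D` (when `P` is trivial), `J` and `H`. If `φ z ≠ 0`, a translate of `t` has
`c = z`, and `P` is the Klein four-group spanned by `φ z` and `z`: this is the family `K`.

Since `F`, `φ` and `z` do not depend on `t`, they separate the families, and `G`, being the odd
part of `F`, is determined by `A`.
-/

namespace SkewBrace

section Basic

variable {A B : Type*} [SkewBrace A] [SkewBrace B]

theorem mul_eq_add_lam (a x : A) : a * x = a + lam A a x :=
  (add_neg_cancel_left a (a * x)).symm

theorem lam_apply_eq_iff {a x y : A} : lam A a x = y ↔ a * x = a + y := by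
  rw [mul_eq_add_lam, add_right_inj]

theorem lam_one_apply (x : A) : lam A 1 x = x := by
  rw [map_one]; rfl

theorem lam_mul_apply (a b x : A) : lam A (a * b) x = lam A a (lam A b x) := by
  rw [map_mul]; rfl

theorem map_lam (E : A ≃+* B) (a x : A) : E (lam A a x) = lam B (E a) (E x) := by
  apply add_left_cancel (a := E a)
  rw [← map_add, ← mul_eq_add_lam, ← mul_eq_add_lam, map_mul]

variable (A) in
/-- The elements of a skew brace fixed by the action `λ`, as a subgroup of its additive group. -/
def lamFixed : AddSubgroup A where
  carrier := {x | ∀ a, lam A a x = x}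
  zero_mem' := fun a => map_zero _
  add_mem' := fun hx hy a => by rw [map_add, hx, hy]
  neg_mem' := fun hx a => by rw [map_neg, hx]

theorem mem_lamFixed {x : A} : x ∈ lamFixed A ↔ ∀ a, lam A a x = x := Iff.rfl

theorem lam_mem_lamFixed_iff {a x : A} : lam A a x ∈ lamFixed A ↔ x ∈ lamFixed A := by
  refine ⟨fun h => ?_, fun h => (h a).symm ▸ h⟩
  have hx := h a⁻¹
  rw [← lam_mul_apply, inv_mul_cancel, lam_one_apply] at hx
  rwa [hx]

theorem map_lamFixed (E : A ≃+* B) :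
    (lamFixed A).map (E.toAddEquiv : A →+ B) = lamFixed B := by
  ext b
  obtain ⟨x, rfl⟩ := E.surjective b
  change (E.toAddEquiv : A →+ B) x ∈ _ ↔ ∀ b, lam B b (E x) = E x
  rw [AddSubgroup.mem_map_iff_mem E.injective, mem_lamFixed, E.surjective.forall]
  simp only [← map_lam, E.injective.eq_iff]

theorem mem_actionOrbit_self (x : A) : x ∈ actionOrbit (lam A) x := ⟨1, lam_one_apply x⟩

theorem one_lt_ncard_actionOrbit_iff [Finite A] {x : A} :
    1 < (actionOrbit (lam A) x).ncard ↔ x ∉ lamFixed A := by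
  rw [← not_iff_not, not_lt, not_not, Set.ncard_le_one]
  exact ⟨fun h a => h _ ⟨a, rfl⟩ _ (mem_actionOrbit_self x), by
    rintro h _ ⟨a, rfl⟩ _ ⟨b, rfl⟩
    exact (h a).trans (h b).symm⟩

theorem ncard_actionOrbit_dvd (x : A) : (actionOrbit (lam A) x).ncard ∣ Nat.card A := by
  let act : MulAction A A := MulAction.compHom A (lam A)
  exact @MulAction.index_stabilizer A A _ act x ▸ Subgroup.index_dvd_card _

end Basic

section Existence

theorem index_eq_two_of_ncard_compl_dvd {A : Type*} [AddGroup A] [Finite A] (H : AddSubgroup A)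
    (h : (H : Set A)ᶜ.ncard ∣ Nat.card A) : H.index = 2 := by
  obtain ⟨q, hq⟩ := Nat.exists_eq_succ_of_ne_zero H.index_ne_zero_of_finite
  have hcompl : (H : Set A)ᶜ.ncard = Nat.card H * q := by
    have hsum := Set.ncard_add_ncard_compl (H : Set A)
    rw [← H.card_mul_index, hq, Nat.mul_succ, ← Nat.card_coe_set_eq] at hsum
    exact Nat.add_left_cancel (hsum.trans (add_comm _ _))
  rw [hcompl, ← H.card_mul_index, hq] at h
  have hdvd : q ∣ q + 1 := Nat.dvd_of_mul_dvd_mul_left Nat.card_pos h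
  rw [hq, Nat.dvd_one.1 ((Nat.dvd_add_right dvd_rfl).1 hdvd)]

variable {A : Type*} [SkewBrace A]

theorem exists_actionOrbit_eq_compl [Finite A] (hA : (lambdaGraph A).HasExactlyOneVertex) :
    ∃ t, actionOrbit (lam A) t = (lamFixed A : Set A)ᶜ := by
  obtain ⟨hsub, ⟨_, ⟨t, rfl⟩, ht⟩⟩ := Nat.card_eq_one_iff_unique.1 hA
  refine ⟨t, Set.Subset.antisymm ?_ fun y hy => ?_⟩
  · rintro _ ⟨a, rfl⟩ hfix
    exact one_lt_ncard_actionOrbit_iff.1 ht (lam_mem_lamFixed_iff.1 hfix)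
  · have horbit : actionOrbit (lam A) t = actionOrbit (lam A) y :=
      Subtype.ext_iff.1 (hsub.elim ⟨_, ⟨t, rfl⟩, ht⟩
        ⟨_, ⟨y, rfl⟩, one_lt_ncard_actionOrbit_iff.2 hy⟩)
    exact horbit ▸ mem_actionOrbit_self y

variable {t : A} (ht : actionOrbit (lam A) t = (lamFixed A : Set A)ᶜ)
include ht

theorem notMem_lamFixed : t ∉ lamFixed A :=
  ht.subset (mem_actionOrbit_self t)

theorem exists_lam_eq_of_notMem {a : A} (ha : a ∉ lamFixed A) : ∃ b, lam A b t = a :=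
  ht.superset ha

variable [Finite A]

theorem index_lamFixed : (lamFixed A).index = 2 :=
  index_eq_two_of_ncard_compl_dvd _ (ht ▸ ncard_actionOrbit_dvd t)

theorem add_mem_lamFixed_iff {a b : A} :
    a + b ∈ lamFixed A ↔ (a ∈ lamFixed A ↔ b ∈ lamFixed A) :=
  AddSubgroup.add_mem_iff_of_index_two (index_lamFixed ht)

theorem add_notMem_lamFixed {x : A} (hx : x ∈ lamFixed A) : x + t ∉ lamFixed A := by
  rw [add_mem_lamFixed_iff ht]
  exact fun h => notMem_lamFixed ht (h.1 hx)

theorem add_eq_neg_add_of_mem_lamFixed {x : A} (hx : x ∈ lamFixed A) : t + x = -x + t := by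
  obtain ⟨a, ha⟩ := exists_lam_eq_of_notMem ht (add_notMem_lamFixed ht hx)
  have hdouble : t + t ∈ lamFixed A := (add_mem_lamFixed_iff ht).2 Iff.rfl
  have hsquare : x + t + (x + t) = t + t := by rw [← ha, ← map_add, hdouble a]
  rw [← add_assoc, add_left_inj, add_assoc] at hsquare
  rw [eq_neg_add_iff_add_eq, hsquare]

theorem add_comm_of_mem_lamFixed {x y : A} (hx : x ∈ lamFixed A) (hy : y ∈ lamFixed A) :
    x + y = y + x := by
  have hneg := add_eq_neg_add_of_mem_lamFixed ht (add_mem hx hy)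
  rw [← add_assoc, add_eq_neg_add_of_mem_lamFixed ht hx, add_assoc,
    add_eq_neg_add_of_mem_lamFixed ht hy, ← add_assoc, add_left_inj, neg_add_rev] at hneg
  have := congrArg Neg.neg hneg
  rwa [neg_add_rev, neg_add_rev, neg_neg, neg_neg, eq_comm] at this

theorem lam_sub_mem_lamFixed (a : A) : lam A a t - t ∈ lamFixed A := by
  rw [sub_eq_add_neg, add_mem_lamFixed_iff ht, neg_mem_iff]
  exact iff_of_false (lam_mem_lamFixed_iff.not.2 (notMem_lamFixed ht)) (notMem_lamFixed ht)

theorem lam_mul_sub (a b : A) :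
    lam A (a * b) t - t = (lam A b t - t) + (lam A a t - t) := by
  have hb : lam A a (lam A b t) - lam A a t = lam A b t - t := by
    rw [← map_sub, lam_sub_mem_lamFixed ht b a]
  rw [lam_mul_apply, ← hb, sub_add_sub_cancel]

theorem exists_mem_lamFixed_eq_self_mul {a : A} (ha : a ∉ lamFixed A) :
    ∃ x ∈ lamFixed A, a = t * x := by
  have hx : -t + a ∈ lamFixed A := by
    rw [add_mem_lamFixed_iff ht, neg_mem_iff]
    exact iff_of_false (notMem_lamFixed ht) ha
  exact ⟨-t + a, hx, by rw [mul_eq_add_lam, hx, add_neg_cancel_left]⟩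

end Existence

end SkewBrace

section Development

open SkewBrace

/-- The skew brace `A` is the disjoint union of the subgroup `ι F`, on which the action `λ` is
trivial, and of the coset `ι F + t`, on which `λ` is transitive. Addition is determined by the facts
that `t` inverts `ι F` and that `2 t = ι z`; the action `λ` is determined by the displacements
`λ_x(t) - t = φ x` of `t` for `x ∈ F` and `λ_t(t) - t = c`. -/
structure IsDihedralExtension {F : Type*} [AddCommGroup F] {A : Type*} [SkewBrace A]
    (φ : F →+ F) (c z : F) (ι : F →+ A) (t : A) : Prop where
  inj : Function.Injective ι
  cover : ∀ a, (∃ x, a = ι x) ∨ ∃ x, a = ι x + t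
  notMem : ∀ x, ι x ≠ t
  add_map : ∀ x, t + ι x = ι (-x) + t
  add_self : t + t = ι z
  lam_map : ∀ a x, lam A a (ι x) = ι x
  lam_map_self : ∀ x, lam A (ι x) t = ι (φ x) + t
  lam_self : lam A t t = ι c + t
  transitive : ∀ y, ∃ x, y = φ x ∨ y = c + φ x

namespace IsDihedralExtension

section

variable {F F' : Type*} [AddCommGroup F] [AddCommGroup F'] {A B : Type*} [SkewBrace A] [SkewBrace B]
  {φ : F →+ F} {c z : F} {ι : F →+ A} {t : A} (h : IsDihedralExtension φ c z ι t)
include h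

theorem map_ne_map_add (x y : F) : ι x ≠ ι y + t := fun e =>
  h.notMem (-y + x) (by rw [map_add, e, map_neg, neg_add_cancel_left])

theorem map_add_inj {x y : F} : ι x + t = ι y + t ↔ x = y := by
  rw [add_left_inj, h.inj.eq_iff]

theorem add_add_map (x y : F) : ι x + t + ι y = ι (x - y) + t := by
  rw [add_assoc, h.add_map, ← add_assoc, ← map_add, sub_eq_add_neg]

theorem add_add_add (x y : F) : ι x + t + (ι y + t) = ι (x - y + z) := by
  rw [← add_assoc, h.add_add_map, add_assoc, h.add_self, ← map_add]

theorem self_mul_map (x : F) : t * ι x = ι (-x) + t := by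
  rw [mul_eq_add_lam, h.lam_map, h.add_map]

theorem map_mul_self (x : F) : ι x * t = ι (x + φ x) + t := by
  rw [mul_eq_add_lam, h.lam_map_self, ← add_assoc, ← map_add]

theorem self_mul_self : t * t = ι (z - c) := by
  rw [mul_eq_add_lam, h.lam_self, ← add_assoc, h.add_map, add_assoc, h.add_self, ← map_add,
    neg_add_eq_sub]

theorem lam_map_add (x y : F) : lam A (ι x) (ι y + t) = ι (φ x + y) + t := by
  rw [map_add, h.lam_map, h.lam_map_self, ← add_assoc, ← map_add, add_comm y]

theorem lam_self_add (y : F) : lam A t (ι y + t) = ι (c + y) + t := by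
  rw [map_add, h.lam_map, h.lam_self, ← add_assoc, ← map_add, add_comm y]

theorem lam_add_self (x : F) : lam A (ι x + t) t = ι (c - φ x) + t := by
  have hprod : ι x + t = t * ι (-x) := by rw [h.self_mul_map, neg_neg]
  rw [hprod, lam_mul_apply, h.lam_map_self, h.lam_self_add, map_neg, sub_eq_add_neg]

theorem lam_add_add (x y : F) : lam A (ι x + t) (ι y + t) = ι (c - φ x + y) + t := by
  rw [map_add, h.lam_map, h.lam_add_self, ← add_assoc, ← map_add, add_comm y]

theorem exists_lam_eq (y y' : F) : ∃ a, lam A a (ι y + t) = ι y' + t := by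
  obtain ⟨x, hx | hx⟩ := h.transitive (y' - y)
  · exact ⟨ι x, by rw [h.lam_map_add, ← hx, sub_add_cancel]⟩
  · exact ⟨ι (-x) + t, by rw [h.lam_add_add, map_neg, sub_neg_eq_add, ← hx, sub_add_cancel]⟩

theorem two_nsmul_eq_zero : 2 • z = 0 := by
  have hz : ι (-z) + t = ι z + t := by rw [← h.add_map, ← h.add_self, add_assoc]
  rw [two_nsmul, ← neg_eq_iff_add_eq_zero, h.map_add_inj.1 hz]

theorem map_map (x : F) : φ (φ x) = (-2 : ℤ) • φ x := by
  have hlam : lam A (ι (x + φ x) + t) t = lam A (ι x * t) t := by rw [h.map_mul_self]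
  rw [lam_mul_apply, h.lam_self, h.lam_map_add, h.lam_add_self, h.map_add_inj, map_add] at hlam
  linear_combination (norm := module) -hlam

theorem map_sub_eq : φ (z - c) = 2 • c := by
  have hlam : lam A (ι (z - c)) t = lam A (t * t) t := by rw [h.self_mul_self]
  rw [lam_mul_apply, h.lam_self, h.lam_self_add, h.lam_map_self, h.map_add_inj] at hlam
  rw [hlam, two_nsmul]

theorem sumElim_bijective :
    Function.Bijective (Sum.elim ι fun x => ι x + t : F ⊕ F → A) := by
  refine ⟨h.inj.sumElim (fun _ _ => h.map_add_inj.1) h.map_ne_map_add, fun a => ?_⟩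
  rcases h.cover a with ⟨x, rfl⟩ | ⟨x, rfl⟩
  exacts [⟨Sum.inl x, rfl⟩, ⟨Sum.inr x, rfl⟩]

theorem nat_card [Finite F] : Nat.card A = 2 * Nat.card F := by
  rw [← Nat.card_congr (Equiv.ofBijective _ h.sumElim_bijective), Nat.card_sum, two_mul]

theorem shift (y : F) : IsDihedralExtension φ (c - φ y) z ι (ι y + t) where
  inj := h.inj
  cover a := by
    rcases h.cover a with ⟨x, rfl⟩ | ⟨x, rfl⟩
    · exact Or.inl ⟨x, rfl⟩
    · exact Or.inr ⟨x - y, by rw [← add_assoc, ← map_add, sub_add_cancel]⟩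
  notMem x := h.map_ne_map_add x y
  add_map x := by rw [h.add_add_map, ← add_assoc, ← map_add, neg_add_eq_sub]
  add_self := by rw [h.add_add_add, sub_self, zero_add]
  lam_map := h.lam_map
  lam_map_self x := by rw [h.lam_map_add, map_add, add_assoc]
  lam_self := by rw [h.lam_add_add, map_add, add_assoc]
  transitive x := by
    obtain ⟨w, hw | hw⟩ := h.transitive x
    · exact ⟨w, Or.inl hw⟩
    · exact ⟨y + w, Or.inr (by rw [hw, map_add, ← add_assoc, sub_add_cancel])⟩

theorem comap (e : F' ≃+ F) {φ' : F' →+ F'} {c' z' : F'} (hφ : ∀ x, e (φ' x) = φ (e x))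
    (hc : e c' = c) (hz : e z' = z) :
    IsDihedralExtension φ' c' z' (ι.comp e.toAddMonoidHom) t where
  inj := h.inj.comp e.injective
  cover a := by
    have ha := h.cover a
    rwa [e.surjective.exists, e.surjective.exists] at ha
  notMem x := h.notMem _
  add_map x := by simpa using h.add_map (e x)
  add_self := by simpa [hz] using h.add_self
  lam_map a x := h.lam_map a (e x)
  lam_map_self x := by simpa [hφ] using h.lam_map_self (e x)
  lam_self := by simpa [hc] using h.lam_self
  transitive y := by
    obtain ⟨x, hx⟩ := h.transitive (e y)
    refine ⟨e.symm x, hx.imp (fun hy => ?_) fun hy => ?_⟩ <;> apply e.injective <;>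
      simpa [hφ, hc] using hy

theorem nonempty_ringEquiv {κ : F →+ B} {s : B} (h' : IsDihedralExtension φ c z κ s) :
    Nonempty (A ≃+* B) := by
  let f : A ≃ B := (Equiv.ofBijective _ h.sumElim_bijective).symm.trans
    (Equiv.ofBijective _ h'.sumElim_bijective)
  have hι : ∀ x, f (ι x) = κ x := fun x =>
    congrArg (Sum.elim κ fun x => κ x + s)
      ((Equiv.ofBijective _ h.sumElim_bijective).symm_apply_apply (Sum.inl x))
  have hιt : ∀ x, f (ι x + t) = κ x + s := fun x =>
    congrArg (Sum.elim κ fun x => κ x + s)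
      ((Equiv.ofBijective _ h.sumElim_bijective).symm_apply_apply (Sum.inr x))
  have hadd : ∀ a b, f (a + b) = f a + f b := by
    intro a b
    rcases h.cover a with ⟨x, rfl⟩ | ⟨x, rfl⟩ <;> rcases h.cover b with ⟨y, rfl⟩ | ⟨y, rfl⟩
    · rw [← map_add, hι, hι, hι, map_add]
    · rw [← add_assoc, ← map_add, hι, hιt, hιt, map_add, add_assoc]
    · rw [h.add_add_map, hιt, hι, hιt, h'.add_add_map]
    · rw [h.add_add_add, hιt, hιt, hι, h'.add_add_add]
  have hlam : ∀ a b, f (lam A a b) = lam B (f a) (f b) := by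
    intro a b
    rcases h.cover b with ⟨y, rfl⟩ | ⟨y, rfl⟩
    · rw [h.lam_map, hι, h'.lam_map]
    rcases h.cover a with ⟨x, rfl⟩ | ⟨x, rfl⟩
    · rw [h.lam_map_add, hι, hιt, hιt, h'.lam_map_add]
    · rw [h.lam_add_add, hιt, hιt, hιt, h'.lam_add_add]
  refine ⟨{ f with map_mul' := fun a b => ?_, map_add' := hadd }⟩
  change f (a * b) = f a * f b
  rw [mul_eq_add_lam, mul_eq_add_lam, hadd, hlam]

theorem range_eq_lamFixed [Nontrivial F] : ι.range = lamFixed A := by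
  refine le_antisymm (by rintro _ ⟨x, rfl⟩ a; exact h.lam_map a x) fun a ha => ?_
  rcases h.cover a with ⟨x, rfl⟩ | ⟨x, rfl⟩
  · exact ⟨x, rfl⟩
  · obtain ⟨y, hy⟩ := exists_ne x
    obtain ⟨b, hb⟩ := h.exists_lam_eq x y
    exact (hy (h.map_add_inj.1 (hb.symm.trans (ha b)))).elim

theorem exists_addEquiv [Nontrivial F] [Nontrivial F'] {φ' : F' →+ F'} {c' z' : F'} {κ : F' →+ B}
    {s : B} (h' : IsDihedralExtension φ' c' z' κ s) (E : A ≃+* B) :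
    ∃ e : F ≃+ F', (∀ x, e (φ x) = φ' (e x)) ∧ e z = z' := by
  have hrange : ι.range.map (E.toAddEquiv : A →+ B) = κ.range := by
    rw [h.range_eq_lamFixed, map_lamFixed, h'.range_eq_lamFixed]
  let e : F ≃+ F' := (AddMonoidHom.ofInjective h.inj).trans <|
    (E.toAddEquiv.addSubgroupMap ι.range).trans <|
    (AddEquiv.addSubgroupCongr hrange).trans (AddMonoidHom.ofInjective h'.inj).symm
  have he : ∀ x, E (ι x) = κ (e x) := fun x =>
    (congrArg Subtype.val ((AddMonoidHom.ofInjective h'.inj).apply_symm_apply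
      ⟨E (ι x), hrange ▸ ⟨ι x, ⟨x, rfl⟩, rfl⟩⟩)).symm
  obtain ⟨y, hy⟩ : ∃ y, E t = κ y + s := by
    refine (h'.cover (E t)).resolve_left ?_
    rintro ⟨y, hy⟩
    rw [← e.apply_symm_apply y, ← he] at hy
    exact h.notMem _ (E.injective hy).symm
  refine ⟨e, fun x => ?_, h'.inj ?_⟩
  · have hlam := congrArg E (h.lam_map_self x)
    rw [map_lam, map_add, he, he, hy, h'.lam_map_add, ← add_assoc, ← map_add, h'.map_add_inj,
      add_left_inj] at hlam
    exact hlam.symm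
  · rw [← he, ← h.add_self, map_add, hy, h'.add_add_add, sub_self, zero_add]

end

theorem hasExactlyOneVertex {F : Type*} [AddCommGroup F] [Finite F] [Nontrivial F] {A : Type u}
    [SkewBrace A] {φ : F →+ F} {c z : F} {ι : F →+ A} {t : A}
    (h : IsDihedralExtension φ c z ι t) : (lambdaGraph A).HasExactlyOneVertex := by
  have : Finite A := Finite.of_surjective _ h.sumElim_bijective.surjective
  have hcoset : ∀ {a}, a ∉ lamFixed A ↔ ∃ x, a = ι x + t := fun {a} => by
    rw [← h.range_eq_lamFixed]
    refine ⟨fun ha => (h.cover a).resolve_left fun ⟨x, hx⟩ => ha ⟨x, hx.symm⟩, ?_⟩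
    rintro ⟨x, rfl⟩ ⟨y, hy⟩
    exact h.map_ne_map_add y x hy
  have horbit : ∀ L : NontrivialOrbit (lam A), L.1 = (lamFixed A : Set A)ᶜ := by
    rintro ⟨_, ⟨b, rfl⟩, hb⟩
    obtain ⟨y, rfl⟩ := hcoset.1 (one_lt_ncard_actionOrbit_iff.1 hb)
    refine Set.Subset.antisymm ?_ fun a ha => ?_
    · rintro _ ⟨a, rfl⟩ hfix
      exact one_lt_ncard_actionOrbit_iff.1 hb (lam_mem_lamFixed_iff.1 hfix)
    · obtain ⟨x, rfl⟩ := hcoset.1 ha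
      exact h.exists_lam_eq y x
  have ht : t ∉ lamFixed A := hcoset.2 ⟨0, by rw [map_zero, zero_add]⟩
  exact Nat.card_eq_one_iff_unique.2
    ⟨⟨fun L M => Subtype.ext ((horbit L).trans (horbit M).symm)⟩,
      ⟨⟨_, ⟨t, rfl⟩, one_lt_ncard_actionOrbit_iff.2 ht⟩⟩⟩

end IsDihedralExtension

namespace SkewBrace

theorem exists_isDihedralExtension {A : Type u} [SkewBrace A] [Finite A]
    (hA : (lambdaGraph A).HasExactlyOneVertex) :
    ∃ (F : Type u) (_ : AddCommGroup F) (φ : F →+ F) (c z : F) (ι : F →+ A) (t : A),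
      Nontrivial F ∧ IsDihedralExtension φ c z ι t := by
  obtain ⟨t, ht⟩ := exists_actionOrbit_eq_compl hA
  let _ : AddCommGroup (lamFixed A) :=
    { (inferInstance : AddGroup (lamFixed A)) with
      add_comm := fun x y => Subtype.ext (add_comm_of_mem_lamFixed ht x.2 y.2) }
  let δ (a : A) : lamFixed A := ⟨lam A a t - t, lam_sub_mem_lamFixed ht a⟩
  have hδ (a : A) : lam A a t = δ a + t := (sub_add_cancel _ _).symm
  have hδ_mul (a b : A) : δ (a * b) = δ b + δ a := Subtype.ext (lam_mul_sub ht a b)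
  let φ : lamFixed A →+ lamFixed A := AddMonoidHom.mk' (fun x => δ x) fun x y => by
    rw [add_comm (δ x), ← hδ_mul, mul_eq_add_lam, y.2, AddSubgroup.coe_add]
  have hcover (a : A) (ha : a ∉ lamFixed A) : ∃ x : lamFixed A, a = x + t := by
    obtain ⟨b, rfl⟩ := exists_lam_eq_of_notMem ht ha
    exact ⟨δ b, hδ b⟩
  have htransitive (y : lamFixed A) : ∃ x, y = φ x ∨ y = δ t + φ x := by
    obtain ⟨a, ha⟩ := exists_lam_eq_of_notMem ht (add_notMem_lamFixed ht y.2)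
    have hy : y = δ a := Subtype.ext (add_right_cancel (ha.symm.trans (hδ a)))
    by_cases hfix : a ∈ lamFixed A
    · exact ⟨⟨a, hfix⟩, Or.inl hy⟩
    · obtain ⟨x, hx, rfl⟩ := exists_mem_lamFixed_eq_self_mul ht hfix
      exact ⟨⟨x, hx⟩, Or.inr (by rw [hy, hδ_mul, add_comm]; rfl)⟩
  refine ⟨lamFixed A, _, φ, δ t, ⟨t + t, (add_mem_lamFixed_iff ht).2 Iff.rfl⟩,
    (lamFixed A).subtype, t, ?_, ?_⟩
  · have hmoved := mem_lamFixed.not.1 (notMem_lamFixed ht)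
    obtain ⟨a, ha⟩ := not_forall.1 hmoved
    exact ⟨δ a, 0, fun h => ha (by rw [hδ, h, AddSubgroup.coe_zero, zero_add])⟩
  · exact
    { inj := Subtype.val_injective
      cover a := (em (a ∈ lamFixed A)).imp (fun ha => ⟨⟨a, ha⟩, rfl⟩) (hcover a)
      notMem x hx := notMem_lamFixed ht (hx ▸ x.2)
      add_map x := add_eq_neg_add_of_mem_lamFixed ht x.2
      add_self := rfl
      lam_map a x := x.2 a
      lam_map_self x := hδ x
      lam_self := hδ t
      transitive := htransitive }

end SkewBrace

section AbelianGroups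

variable {P P' G G' : Type*} [AddCommGroup P] [AddCommGroup P'] [AddCommGroup G] [AddCommGroup G']

theorem map_eq_zero_of_coprime_card (h : (Nat.card P).Coprime (Nat.card G)) (f : P →+ G) (x : P) :
    f x = 0 :=
  AddMonoid.addOrderOf_eq_one_iff.1 <| Nat.eq_one_of_dvd_coprimes h
    ((addOrderOf_map_dvd f x).trans (addOrderOf_dvd_natCard x)) (addOrderOf_dvd_natCard _)

theorem exists_eq_prodMap_of_coprime_card (hPG' : (Nat.card P).Coprime (Nat.card G'))
    (hGP' : (Nat.card G).Coprime (Nat.card P')) (f : P × G →+ P' × G') :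
    ∃ (f₁ : P →+ P') (f₂ : G →+ G'), f = f₁.prodMap f₂ := by
  let fP := f.comp (AddMonoidHom.inl P G)
  let fG := f.comp (AddMonoidHom.inr P G)
  refine ⟨(AddMonoidHom.fst P' G').comp fP, (AddMonoidHom.snd P' G').comp fG, ?_⟩
  ext1 ⟨x, y⟩
  have hsplit : f (x, y) = fP x + fG y :=
    (DFunLike.congr_fun (AddMonoidHom.coprod_unique f) (x, y)).symm
  have hx : (fP x).2 = 0 := map_eq_zero_of_coprime_card hPG' ((AddMonoidHom.snd P' G').comp fP) x
  have hy : (fG y).1 = 0 := map_eq_zero_of_coprime_card hGP' ((AddMonoidHom.fst P' G').comp fG) y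
  rw [hsplit]
  exact Prod.ext (by simp [hy]) (by simp [hx])

theorem exists_eq_prodCongr_of_coprime_card (hPG' : (Nat.card P).Coprime (Nat.card G'))
    (hGP' : (Nat.card G).Coprime (Nat.card P')) (e : P × G ≃+ P' × G') :
    ∃ (e₁ : P ≃+ P') (e₂ : G ≃+ G'), e = e₁.prodCongr e₂ := by
  obtain ⟨f₁, f₂, hf⟩ := exists_eq_prodMap_of_coprime_card hPG' hGP' (e : P × G →+ P' × G')
  have hbij : Function.Bijective (Prod.map f₁ f₂) := by
    rw [← AddMonoidHom.coe_prodMap, ← hf]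
    exact e.bijective
  rw [Prod.map_bijective] at hbij
  exact ⟨AddEquiv.ofBijective f₁ hbij.1, AddEquiv.ofBijective f₂ hbij.2,
    AddEquiv.ext fun x => DFunLike.congr_fun hf x⟩

theorem exists_prod_addEquiv_of_card_eq {F : Type u} [AddCommGroup F] [Finite F] {p i d : ℕ}
    [Fact p.Prime] (hd : p.Coprime d) (hF : Nat.card F = p ^ i * d) :
    ∃ (P G : Type u) (_ : AddCommGroup P) (_ : AddCommGroup G),
      Nat.card P = p ^ i ∧ Nat.card G = d ∧ Nonempty (P × G ≃+ F) := by
  obtain ⟨P, hP⟩ := Sylow.exists_subgroup_card_pow_prime (G := Multiplicative F) p ⟨d, hF⟩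
  have hindex : P.index = d := by
    refine Nat.eq_of_mul_eq_mul_left (Nat.card_pos (α := P)) ?_
    rw [P.card_mul_index, hP]
    exact hF
  obtain ⟨G, hPG⟩ := P.exists_right_complement'_of_coprime (by
    rw [hP, hindex]
    exact hd.pow_left i)
  let f : Additive P × Additive G →+ F :=
    (MonoidHom.toAdditiveLeft P.subtype).coprod (MonoidHom.toAdditiveLeft G.subtype)
  exact ⟨Additive P, Additive G, inferInstance, inferInstance, hP,
    (hPG.symm.index_eq_card.symm.trans hindex), ⟨AddEquiv.ofBijective f hPG⟩⟩

theorem eq_top_of_forall_exists_sub_nsmul_mem {n k : ℕ} (hP : ∀ x : P, n ^ k • x = 0)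
    {H : AddSubgroup P} (hH : ∀ y, ∃ x, y - n • x ∈ H) : H = ⊤ := by
  have hpow : ∀ j y, ∃ x, y - n ^ j • x ∈ H := by
    intro j
    induction j with
    | zero => exact fun y => ⟨y, by simp⟩
    | succ j ih =>
      intro y
      obtain ⟨x, hx⟩ := ih y
      obtain ⟨w, hw⟩ := hH x
      refine ⟨w, ?_⟩
      convert H.add_mem hx (H.nsmul_mem hw (n ^ j)) using 1
      rw [smul_sub, smul_smul, ← pow_succ, sub_add_sub_cancel]
  refine (AddSubgroup.eq_top_iff' H).2 fun y => ?_
  obtain ⟨x, hx⟩ := hpow k y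
  rwa [hP, sub_zero] at hx

theorem exists_zmod_addMonoidHom_map_one_eq {n : ℕ} {c : P} (hc : n • c = 0) :
    ∃ f : ZMod n →+ P, f 1 = c := by
  have hn : zmultiplesHom P c n = 0 := by rw [zmultiplesHom_apply, natCast_zsmul, hc]
  refine ⟨ZMod.lift n ⟨zmultiplesHom P c, hn⟩, ?_⟩
  rw [← Int.cast_one, ZMod.lift_coe]
  exact one_zsmul c

theorem exists_zmod_addEquiv_of_zmultiples_eq_top {n : ℕ} [NeZero n] (hP : Nat.card P = n) {c : P}
    (hc : AddSubgroup.zmultiples c = ⊤) : ∃ e : ZMod n ≃+ P, e 1 = c := by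
  obtain ⟨f, hf⟩ := exists_zmod_addMonoidHom_map_one_eq (n := n) (c := c)
    (hP ▸ card_nsmul_eq_zero')
  have hsurj : Function.Surjective f := by
    rw [← AddMonoidHom.range_eq_top, eq_top_iff, ← hc, AddSubgroup.zmultiples_le]
    exact ⟨1, hf⟩
  exact ⟨AddEquiv.ofBijective f (hsurj.bijective_of_nat_card_le (by rw [Nat.card_zmod, hP])), hf⟩

theorem zmod_eq_zero_or_eq_of_two_nsmul_eq_zero {i : ℕ} {a : ZMod (2 ^ (i + 1))}
    (ha : 2 • a = 0) : a = 0 ∨ a = 2 ^ i := by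
  have hdvd : 2 ^ i * 2 ∣ a.val * 2 := by
    rw [← pow_succ, ← ZMod.natCast_eq_zero_iff, mul_comm, Nat.cast_mul, ZMod.natCast_zmod_val]
    simpa using ha
  obtain ⟨k, hk⟩ := Nat.dvd_of_mul_dvd_mul_right two_pos hdvd
  have hk2 : k < 2 := by
    refine Nat.lt_of_mul_lt_mul_left (a := 2 ^ i) ?_
    rw [← hk, ← pow_succ]
    exact ZMod.val_lt a
  rw [← ZMod.natCast_zmod_val a, hk]
  interval_cases k <;> simp

end AbelianGroups

/-- The endomorphism `x ↦ -2 x` of an abelian group. -/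
def negTwo (G : Type*) [AddCommGroup G] : G →+ G := zsmulAddGroupHom (-2)

theorem negTwo_apply {G : Type*} [AddCommGroup G] (x : G) : negTwo G x = (-2 : ℤ) • x := rfl

theorem add_negTwo {G : Type*} [AddCommGroup G] (x : G) : x + negTwo G x = -x := by
  rw [negTwo_apply]
  module

theorem negTwo_surjective_of_odd_card {G : Type*} [AddCommGroup G] (hG : Odd (Nat.card G)) :
    Function.Surjective (negTwo G) := by
  intro y
  obtain ⟨x, rfl⟩ := (nsmulCoprime hG.coprime_two_right).surjective y
  exact ⟨-x, by rw [negTwo_apply, nsmulCoprime_apply]; module⟩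

/-- The constraints that the parameters `(φ, c, z)` of a dihedral extension satisfy. -/
structure IsDihedralDatum {F : Type*} [AddCommGroup F] (φ : F →+ F) (c z : F) : Prop where
  map_map : ∀ x, φ (φ x) = negTwo F (φ x)
  map_sub_eq : φ (z - c) = 2 • c
  two_nsmul_eq_zero : 2 • z = 0
  transitive : ∀ y, ∃ x, y = φ x ∨ y = c + φ x

theorem IsDihedralExtension.isDihedralDatum {F A : Type*} [AddCommGroup F] [SkewBrace A]
    {φ : F →+ F} {c z : F} {ι : F →+ A} {t : A} (h : IsDihedralExtension φ c z ι t) :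
    IsDihedralDatum φ c z :=
  ⟨h.map_map, h.map_sub_eq, h.two_nsmul_eq_zero, h.transitive⟩

namespace IsDihedralDatum

section

variable {P G : Type*} [AddCommGroup P] [AddCommGroup G] {φ : P →+ P} {c z : P} {ψ : G →+ G}
  {c' z' : G}

theorem fst (h : IsDihedralDatum (φ.prodMap ψ) (c, c') (z, z')) : IsDihedralDatum φ c z where
  map_map x := congrArg Prod.fst (h.map_map (x, 0))
  map_sub_eq := congrArg Prod.fst h.map_sub_eq
  two_nsmul_eq_zero := congrArg Prod.fst h.two_nsmul_eq_zero
  transitive y := by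
    obtain ⟨x, hx⟩ := h.transitive (y, 0)
    exact ⟨x.1, hx.imp (congrArg Prod.fst) (congrArg Prod.fst)⟩

theorem snd (h : IsDihedralDatum (φ.prodMap ψ) (c, c') (z, z')) : IsDihedralDatum ψ c' z' where
  map_map x := congrArg Prod.snd (h.map_map (0, x))
  map_sub_eq := congrArg Prod.snd h.map_sub_eq
  two_nsmul_eq_zero := congrArg Prod.snd h.two_nsmul_eq_zero
  transitive y := by
    obtain ⟨x, hx⟩ := h.transitive (0, y)
    exact ⟨x.2, hx.imp (congrArg Prod.snd) (congrArg Prod.snd)⟩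

end

variable {F : Type*} [AddCommGroup F] {φ : F →+ F} {c z : F} (h : IsDihedralDatum φ c z)
include h

theorem map_eq_or (y : F) : φ y = negTwo F y ∨ φ y = negTwo F y + φ z := by
  have hc : φ c = negTwo F c + φ z := by
    have hsub := h.map_sub_eq
    rw [map_sub, two_nsmul] at hsub
    rw [negTwo_apply]
    linear_combination (norm := module) -hsub
  obtain ⟨x, rfl | rfl⟩ := h.transitive y
  · exact Or.inl (h.map_map x)
  · right
    rw [map_add, hc, h.map_map, map_add]
    abel

theorem eq_negTwo (hz : φ z = 0) : φ = negTwo F := by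
  ext y
  simpa [hz] using h.map_eq_or y

theorem eq_zero_of_odd_card (hF : Odd (Nat.card F)) : z = 0 :=
  AddMonoid.addOrderOf_eq_one_iff.1 <| Nat.eq_one_of_dvd_coprimes hF.coprime_two_right
    (addOrderOf_dvd_natCard z) (addOrderOf_dvd_of_nsmul_eq_zero h.two_nsmul_eq_zero)

theorem zmultiples_eq_top (hz : φ z = 0) {k : ℕ} (hF : Nat.card F = 2 ^ k) :
    AddSubgroup.zmultiples c = ⊤ := by
  refine eq_top_of_forall_exists_sub_nsmul_mem (n := 2) (k := k)
    (fun x => by rw [← hF, card_nsmul_eq_zero']) fun y => ?_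
  have hφ (x : F) : φ x = 2 • (-x) := by
    rw [h.eq_negTwo hz, negTwo_apply]
    module
  obtain ⟨x, rfl | rfl⟩ := h.transitive y
  · exact ⟨-x, by rw [hφ, sub_self]; exact zero_mem _⟩
  · exact ⟨-x, by rw [hφ, add_sub_cancel_right]; exact AddSubgroup.mem_zmultiples c⟩

theorem exists_eq_add_map (hz : φ z ≠ 0) : ∃ x, z = c + φ x := by
  obtain ⟨x, rfl | hx⟩ := h.transitive z
  · refine (hz ?_).elim
    rw [h.map_map, negTwo_apply, neg_smul, neg_eq_zero]
    exact_mod_cast h.two_nsmul_eq_zero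
  · exact ⟨x, hx⟩

end IsDihedralDatum

/-- The endomorphism `(a, b) ↦ (b, 0)` of the Klein four-group. -/
def kleinShift : ZMod 2 × ZMod 2 →+ ZMod 2 × ZMod 2 :=
  (AddMonoidHom.inl (ZMod 2) (ZMod 2)).comp (AddMonoidHom.snd (ZMod 2) (ZMod 2))

namespace IsDihedralDatum

variable {P : Type*} [AddCommGroup P] {φ : P →+ P} {z : P}

theorem exists_klein_addMonoidHom (h : IsDihedralDatum φ z z) :
    ∃ f : ZMod 2 × ZMod 2 →+ P, (∀ x, f (kleinShift x) = φ (f x)) ∧ f (0, 1) = z := by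
  have hz2 : 2 • z = 0 := h.two_nsmul_eq_zero
  have hφz2 : 2 • φ z = 0 := by rw [← map_nsmul, hz2, map_zero]
  have hφφz : φ (φ z) = 0 := by
    rw [h.map_map, negTwo_apply, neg_smul, neg_eq_zero]
    exact_mod_cast hφz2
  obtain ⟨f, hf⟩ := exists_zmod_addMonoidHom_map_one_eq hφz2
  obtain ⟨g, hg⟩ := exists_zmod_addMonoidHom_map_one_eq hz2
  have hφf (a : ZMod 2) : φ (f a) = 0 := by
    rcases zmod2_cases a with rfl | rfl <;> simp [hf, hφφz]
  have hφg (b : ZMod 2) : φ (g b) = f b := by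
    rcases zmod2_cases b with rfl | rfl <;> simp [hf, hg]
  exact ⟨f.coprod g, fun x => by simp [kleinShift, hφf, hφg], by simp [hg]⟩

theorem exists_klein_addEquiv (h : IsDihedralDatum φ z z) (hz : φ z ≠ 0) {k : ℕ}
    (hP : Nat.card P = 2 ^ k) :
    ∃ e : ZMod 2 × ZMod 2 ≃+ P, (∀ x, e (kleinShift x) = φ (e x)) ∧ e (0, 1) = z := by
  obtain ⟨f, hφ, hfz⟩ := h.exists_klein_addMonoidHom
  have hφz : φ z = f (1, 0) := hfz ▸ (hφ (0, 1)).symm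
  have hfst (a : ZMod 2) (ha : f (a, 0) = 0) : a = 0 := by
    rcases zmod2_cases a with rfl | rfl
    exacts [rfl, (hz (hφz.trans ha)).elim]
  have hinj : Function.Injective f := by
    refine (injective_iff_map_eq_zero _).2 fun ⟨a, b⟩ hab => ?_
    obtain rfl : b = 0 := hfst b ((hφ (a, b)).trans (by rw [hab, map_zero]))
    rw [hfst a hab, Prod.mk_zero_zero]
  have hsurj : Function.Surjective f := by
    rw [← AddMonoidHom.range_eq_top]
    refine eq_top_of_forall_exists_sub_nsmul_mem (n := 2) (k := k)
      (fun x => by rw [← hP, card_nsmul_eq_zero']) fun y => ?_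
    obtain ⟨b, x, rfl⟩ : ∃ b x, y = f b + φ x := by
      obtain ⟨x, hy | hy⟩ := h.transitive y
      exacts [⟨0, x, by rw [hy, map_zero, zero_add]⟩, ⟨(0, 1), x, by rw [hy, hfz]⟩]
    obtain ⟨a, ha⟩ : ∃ a, φ x = f a + 2 • (-x) := by
      rcases h.map_eq_or x with hx | hx
      · exact ⟨0, by rw [hx, negTwo_apply, map_zero]; module⟩
      · exact ⟨(1, 0), by rw [hx, hφz, negTwo_apply]; module⟩
    exact ⟨-x, b + a, by rw [map_add, ha]; abel⟩
  exact ⟨AddEquiv.ofBijective f ⟨hinj, hsurj⟩, hφ, hfz⟩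

end IsDihedralDatum

/-- The skew brace `A` is a dihedral extension of `P × G` whose parameters are `(ψ, c, z)` on `P`
and `(-2, 0, 0)` on `G`; in the classification `P` is a `2`-group and `G` has odd order. -/
def IsSplitDihedral {P : Type*} [AddCommGroup P] (ψ : P →+ P) (c z : P) (G A : Type*)
    [AddCommGroup G] [SkewBrace A] : Prop :=
  ∃ (ι : P × G →+ A) (t : A), IsDihedralExtension (ψ.prodMap (negTwo G)) (c, 0) (z, 0) ι t

namespace IsSplitDihedral

section

variable {P P' G G' A B : Type*} [AddCommGroup P] [AddCommGroup P'] [AddCommGroup G]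
  [AddCommGroup G'] [SkewBrace A] [SkewBrace B] {ψ : P →+ P} {c z : P} {ψ' : P' →+ P'} {c' z' : P'}

theorem isDihedralDatum (h : IsSplitDihedral ψ c z G A) : IsDihedralDatum ψ c z := by
  obtain ⟨ι, t, h⟩ := h
  exact h.isDihedralDatum.fst

theorem nat_card [Finite P] [Finite G] (h : IsSplitDihedral ψ c z G A) :
    Nat.card A = 2 * (Nat.card P * Nat.card G) := by
  obtain ⟨ι, t, h⟩ := h
  rw [h.nat_card, Nat.card_prod]

theorem congr (h : IsSplitDihedral ψ c z G A) (e₁ : P' ≃+ P) (e₂ : G' ≃+ G)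
    (hψ : ∀ x, e₁ (ψ' x) = ψ (e₁ x)) (hc : e₁ c' = c) (hz : e₁ z' = z) :
    IsSplitDihedral ψ' c' z' G' A := by
  obtain ⟨ι, t, h⟩ := h
  exact ⟨_, t, h.comap (e₁.prodCongr e₂) (fun x => Prod.ext (hψ x.1) (map_zsmul e₂ _ _))
    (Prod.ext hc (map_zero e₂)) (Prod.ext hz (map_zero e₂))⟩

theorem shift (h : IsSplitDihedral ψ c z G A) (y : P) : IsSplitDihedral ψ (c - ψ y) z G A := by
  obtain ⟨ι, t, h⟩ := h
  have hs := h.shift (y, 0)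
  rw [AddMonoidHom.coe_prodMap, Prod.map_apply, map_zero, Prod.mk_sub_mk, sub_zero] at hs
  exact ⟨ι, _, hs⟩

theorem nonempty_ringEquiv (h : IsSplitDihedral ψ c z G A) (h' : IsSplitDihedral ψ c z G' B)
    (e : G ≃+ G') : Nonempty (A ≃+* B) := by
  obtain ⟨ι, t, h⟩ := h
  obtain ⟨κ, s, h'⟩ := h'.congr (.refl P) e (ψ' := ψ) (fun _ => rfl) rfl rfl
  exact h.nonempty_ringEquiv h'

theorem exists_addEquiv [Nontrivial (P × G)] [Nontrivial (P' × G')]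
    (h : IsSplitDihedral ψ c z G A) (h' : IsSplitDihedral ψ' c' z' G' B)
    (hPG' : (Nat.card P).Coprime (Nat.card G')) (hGP' : (Nat.card G).Coprime (Nat.card P'))
    (E : A ≃+* B) :
    Nonempty (G ≃+ G') ∧ ∃ e : P ≃+ P', (∀ x, e (ψ x) = ψ' (e x)) ∧ e z = z' := by
  obtain ⟨ι, t, h⟩ := h
  obtain ⟨κ, s, h'⟩ := h'
  obtain ⟨e, hφ, hz⟩ := h.exists_addEquiv h' E
  obtain ⟨e₁, e₂, rfl⟩ := exists_eq_prodCongr_of_coprime_card hPG' hGP' e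
  exact ⟨⟨e₂⟩, e₁, fun x => congrArg Prod.fst (hφ (x, 0)), congrArg Prod.fst hz⟩

theorem nonempty_ringEquiv_iff [Finite P] [Finite G] [Finite G']
    (h : IsSplitDihedral ψ c z G A) (h' : IsSplitDihedral ψ c z G' B)
    (hPG : (Nat.card P).Coprime (Nat.card G)) (hPG' : (Nat.card P).Coprime (Nat.card G')) :
    Nonempty (A ≃+* B) ↔ Nonempty (G ≃+ G') := by
  refine ⟨fun ⟨E⟩ => ?_, fun ⟨e⟩ => h.nonempty_ringEquiv h' e⟩
  have hcard : Nat.card (P × G) = Nat.card (P × G') := by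
    have hAB := Nat.card_congr E.toEquiv
    rw [h.nat_card, h'.nat_card] at hAB
    rw [Nat.card_prod, Nat.card_prod, Nat.eq_of_mul_eq_mul_left two_pos hAB]
  rcases subsingleton_or_nontrivial (P × G) with hP | hP
  · have : Subsingleton (P × G') := by
      rwa [← Finite.card_le_one_iff_subsingleton, ← hcard, Finite.card_le_one_iff_subsingleton]
    have : Subsingleton G := (Prod.mk_right_injective (0 : P)).subsingleton
    have : Subsingleton G' := (Prod.mk_right_injective (0 : P)).subsingleton
    exact ⟨AddEquiv.ofBijective (0 : G →+ G')
      ⟨Function.injective_of_subsingleton _, Function.surjective_to_subsingleton _⟩⟩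
  · have : Nontrivial (P × G') := by
      rwa [← Finite.one_lt_card_iff_nontrivial, ← hcard, Finite.one_lt_card_iff_nontrivial]
    exact (h.exists_addEquiv h' hPG' hPG.symm E).1

end

theorem hasExactlyOneVertex {P G : Type*} {A : Type u} [AddCommGroup P] [AddCommGroup G]
    [SkewBrace A] [Finite P] [Finite G] [Nontrivial (P × G)] {ψ : P →+ P} {c z : P}
    (h : IsSplitDihedral ψ c z G A) : (lambdaGraph A).HasExactlyOneVertex := by
  obtain ⟨ι, t, h⟩ := h
  exact h.hasExactlyOneVertex

end IsSplitDihedral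

theorem IsDihedralExtension.exists_isSplitDihedral {F P G A : Type*} [AddCommGroup F]
    [AddCommGroup P] [AddCommGroup G] [SkewBrace A] {φ : F →+ F} {c z : F} {ι : F →+ A} {t : A}
    (h : IsDihedralExtension φ c z ι t) (e : P × G ≃+ F) (hG : Odd (Nat.card G))
    (hPG : (Nat.card P).Coprime (Nat.card G)) :
    ∃ (ψ : P →+ P) (c z : P), IsSplitDihedral ψ c z G A := by
  obtain ⟨ψ, χ, hφ⟩ := exists_eq_prodMap_of_coprime_card hPG hPG.symm
    ((e.symm.toAddMonoidHom.comp φ).comp e.toAddMonoidHom)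
  obtain ⟨⟨c, w⟩, rfl⟩ := e.surjective c
  obtain ⟨⟨z, v⟩, rfl⟩ := e.surjective z
  have h := h.comap e (φ' := ψ.prodMap χ) (fun x => by simp [← hφ]) rfl rfl
  have hodd := h.isDihedralDatum.snd
  obtain rfl : v = 0 := hodd.eq_zero_of_odd_card hG
  obtain rfl : χ = negTwo G := hodd.eq_negTwo (map_zero χ)
  obtain ⟨x, rfl⟩ := negTwo_surjective_of_odd_card hG w
  have h := h.shift (0, x)
  rw [AddMonoidHom.coe_prodMap, Prod.map_apply, map_zero, Prod.mk_sub_mk, sub_zero, sub_self] at h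
  exact ⟨ψ, c, z, _, _, h⟩

theorem SkewBrace.exists_isSplitDihedral {A : Type u} [SkewBrace A] [Finite A] {m d : ℕ}
    (hd : Odd d) (hA : Nat.card A = 2 ^ m * d) (hΛ : (lambdaGraph A).HasExactlyOneVertex) :
    ∃ i, m = i + 1 ∧ ∃ (P G : Type u) (_ : AddCommGroup P) (_ : AddCommGroup G) (ψ : P →+ P)
      (c z : P), Nat.card P = 2 ^ i ∧ Nat.card G = d ∧ Nontrivial (P × G) ∧
        IsSplitDihedral ψ c z G A := by
  obtain ⟨F, _, φ, c, z, ι, t, _, h⟩ := exists_isDihedralExtension hΛ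
  have : Finite F := Finite.of_injective ι h.inj
  rw [h.nat_card] at hA
  obtain _ | i := m
  · exact (Nat.not_even_iff_odd.2 hd ⟨Nat.card F, by rw [← two_mul, hA, pow_zero, one_mul]⟩).elim
  have hF : Nat.card F = 2 ^ i * d := by
    rw [pow_succ', mul_assoc] at hA
    exact Nat.eq_of_mul_eq_mul_left two_pos hA
  obtain ⟨P, G, _, _, hP, rfl, ⟨e⟩⟩ := exists_prod_addEquiv_of_card_eq hd.coprime_two_left hF
  obtain ⟨ψ, c, z, h⟩ := h.exists_isSplitDihedral e hd (hP ▸ hd.coprime_two_left.pow_left i)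
  exact ⟨i, rfl, P, G, _, _, ψ, c, z, hP, rfl, e.nontrivial, h⟩

section Families

variable {G : Type u} [AddCommGroup G]

theorem zmod_exists_eq_negTwo_or (n : ℕ) (y : ZMod n) :
    ∃ x, y = negTwo (ZMod n) x ∨ y = 1 + negTwo (ZMod n) x := by
  obtain ⟨k, rfl⟩ := ZMod.intCast_surjective y
  obtain ⟨l, rfl | rfl⟩ := Int.even_or_odd' k
  · exact ⟨-l, Or.inl (by simp [negTwo_apply])⟩
  · exact ⟨-l, Or.inr (by simp [negTwo_apply, add_comm])⟩

theorem kleinShift_exists_eq_or (y : ZMod 2 × ZMod 2) :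
    ∃ x, y = kleinShift x ∨ y = (0, 1) + kleinShift x := by
  obtain ⟨a, b⟩ := y
  rcases zmod2_cases b with rfl | rfl
  exacts [⟨(0, a), Or.inl rfl⟩, ⟨(0, a), Or.inr (by simp [kleinShift])⟩]

theorem exists_eq_prodMap_negTwo_or {P : Type*} [AddCommGroup P] {ψ : P →+ P} {c : P}
    (hψ : ∀ y, ∃ x, y = ψ x ∨ y = c + ψ x) (hG : Odd (Nat.card G)) (y : P × G) :
    ∃ x, y = ψ.prodMap (negTwo G) x ∨ y = (c, 0) + ψ.prodMap (negTwo G) x := by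
  obtain ⟨y, w⟩ := y
  obtain ⟨v, rfl⟩ := negTwo_surjective_of_odd_card hG w
  obtain ⟨x, hx⟩ := hψ y
  exact ⟨(x, v), hx.imp (fun h => by simp [h]) (fun h => by simp [h])⟩

theorem DBrace.isSplitDihedral (hG : Odd (Nat.card G)) :
    IsSplitDihedral (negTwo (ZMod (2 ^ 0))) 1 0 G (DBrace G) := by
  refine ⟨AddMonoidHom.mk' (fun x => ⟨x.2, 0⟩) fun x y => by simp [add_def, zsgn_zero],
    ⟨0, 1⟩, ?_⟩
  exact
  { inj x y h := Prod.ext (Subsingleton.elim (α := ZMod 1) _ _) (DBrace.ext_iff.1 h).1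
    cover := by
      rintro ⟨g, k⟩
      rcases zmod2_cases k with rfl | rfl
      · exact Or.inl ⟨(0, g), rfl⟩
      · exact Or.inr ⟨(0, g), by simp [add_def]⟩
    notMem x h := zero_ne_one (DBrace.ext_iff.1 h).2
    add_map x := by simp [add_def, zsgn_zero, zsgn_one]
    add_self := by simp [add_def, zmod2_one_add_one]
    lam_map a x := lam_apply_eq_iff.2 (by simp [add_def, mul_def, zsgn_zero])
    lam_map_self x := lam_apply_eq_iff.2 (by
      simp [add_def, mul_def, zsgn_zero, zsgn_one, add_negTwo])
    lam_self := lam_apply_eq_iff.2 (by simp [add_def, mul_def])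
    transitive := exists_eq_prodMap_negTwo_or (zmod_exists_eq_negTwo_or _) hG }

theorem JBrace.isSplitDihedral (i : ℕ) (hG : Odd (Nat.card G)) :
    IsSplitDihedral (negTwo (ZMod (2 ^ i))) 1 0 G (JBrace i G) := by
  refine ⟨AddMonoidHom.mk' (fun x => ⟨x.1, x.2, 0⟩) fun x y => by simp [add_def, zsgn_zero],
    ⟨0, 0, 1⟩, ?_⟩
  exact
  { inj x y h := Prod.ext (JBrace.ext_iff.1 h).1 (JBrace.ext_iff.1 h).2.1
    cover := by
      rintro ⟨a, g, k⟩
      rcases zmod2_cases k with rfl | rfl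
      · exact Or.inl ⟨(a, g), rfl⟩
      · exact Or.inr ⟨(a, g), by simp [add_def]⟩
    notMem x h := zero_ne_one (JBrace.ext_iff.1 h).2.2
    add_map x := by simp [add_def, zsgn_zero, zsgn_one]
    add_self := by simp [add_def, zmod2_one_add_one]
    lam_map a x := lam_apply_eq_iff.2 (by simp [add_def, mul_def, zsgn_zero])
    lam_map_self x := lam_apply_eq_iff.2 (by
      simp [add_def, mul_def, zsgn_zero, zsgn_one, add_negTwo])
    lam_self := lam_apply_eq_iff.2 (by simp [add_def, mul_def, zsgn_one, zmod2_val_one])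
    transitive := exists_eq_prodMap_negTwo_or (zmod_exists_eq_negTwo_or _) hG }

theorem HBrace.isSplitDihedral (i : ℕ) (hG : Odd (Nat.card G)) :
    IsSplitDihedral (negTwo (ZMod (2 ^ i))) 1 (2 ^ (i - 1)) G (HBrace i G) := by
  refine ⟨AddMonoidHom.mk' (fun x => ⟨x.1, x.2, 0⟩) fun x y => by
    simp [add_def, zsgn_zero, cocycle], ⟨0, 0, 1⟩, ?_⟩
  exact
  { inj x y h := Prod.ext (HBrace.ext_iff.1 h).1 (HBrace.ext_iff.1 h).2.1
    cover := by
      rintro ⟨a, g, k⟩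
      rcases zmod2_cases k with rfl | rfl
      · exact Or.inl ⟨(a, g), rfl⟩
      · exact Or.inr ⟨(a, g), by simp [add_def, cocycle]⟩
    notMem x h := zero_ne_one (HBrace.ext_iff.1 h).2.2
    add_map x := by simp [add_def, zsgn_zero, zsgn_one, cocycle]
    add_self := by simp [add_def, zmod2_one_add_one, zmod2_val_one, cocycle]
    lam_map a x := lam_apply_eq_iff.2 (by simp [add_def, mul_def, zsgn_zero, cocycle])
    lam_map_self x := lam_apply_eq_iff.2 (by
      simp [add_def, mul_def, zsgn_zero, zsgn_one, cocycle, add_negTwo])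
    lam_self := lam_apply_eq_iff.2 (by
      simp [add_def, mul_def, zsgn_one, zmod2_val_one, cocycle])
    transitive := exists_eq_prodMap_negTwo_or (zmod_exists_eq_negTwo_or _) hG }

theorem KBrace.isSplitDihedral (hG : Odd (Nat.card G)) :
    IsSplitDihedral kleinShift (0, 1) (0, 1) G (KBrace G) := by
  refine ⟨AddMonoidHom.mk' (fun x => ⟨x.1.1, x.1.2, x.2, 0⟩) fun x y => by
    simp [add_def, zsgn_zero], ⟨0, 0, 0, 1⟩, ?_⟩
  exact
  { inj x y h := Prod.ext (Prod.ext (KBrace.ext_iff.1 h).1 (KBrace.ext_iff.1 h).2.1)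
      (KBrace.ext_iff.1 h).2.2.1
    cover := by
      rintro ⟨a, b, g, k⟩
      rcases zmod2_cases k with rfl | rfl
      · exact Or.inl ⟨((a, b), g), rfl⟩
      · exact Or.inr ⟨((a, b), g), by simp [add_def]⟩
    notMem x h := zero_ne_one (KBrace.ext_iff.1 h).2.2.2
    add_map x := by simp [add_def, zsgn_zero, zsgn_one, ZModModule.neg_eq_self]
    add_self := by simp [add_def, zmod2_one_add_one]
    lam_map a x := lam_apply_eq_iff.2 (by simp [add_def, mul_def, zsgn_zero])
    lam_map_self x := lam_apply_eq_iff.2 (by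
      simp [add_def, mul_def, zsgn_zero, zsgn_one, kleinShift, add_negTwo])
    lam_self := lam_apply_eq_iff.2 (by
      simp [add_def, mul_def, zmod2_one_add_one])
    transitive := exists_eq_prodMap_negTwo_or kleinShift_exists_eq_or hG }

end Families

section Families

variable {α : Type*} {i : ℕ}

theorem finite_of_odd_card (h : Odd (Nat.card α)) : Finite α :=
  Nat.finite_of_card_ne_zero h.pos.ne'

theorem zmod_two_pow_nontrivial (hi : i ≠ 0) : Nontrivial (ZMod (2 ^ i)) :=
  ZMod.nontrivial_iff.2 (Nat.one_lt_two_pow hi).ne'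

theorem card_zmod_two_pow_coprime (h : Odd (Nat.card α)) :
    (Nat.card (ZMod (2 ^ i))).Coprime (Nat.card α) := by
  rw [Nat.card_zmod]
  exact h.coprime_two_left.pow_left i

theorem card_klein_coprime (h : Odd (Nat.card α)) :
    (Nat.card (ZMod 2 × ZMod 2)).Coprime (Nat.card α) := by
  rw [Nat.card_prod, Nat.card_zmod]
  exact h.coprime_two_left.mul_left h.coprime_two_left

variable {G G' : Type u} [AddCommGroup G] [AddCommGroup G']

namespace DBrace

theorem nat_card (hG : Odd (Nat.card G)) : Nat.card (DBrace G) = 2 * Nat.card G := by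
  have := finite_of_odd_card hG
  rw [(isSplitDihedral hG).nat_card, Nat.card_zmod, pow_zero, one_mul]

theorem hasExactlyOneVertex (hG : Odd (Nat.card G)) (h1 : Nat.card G ≠ 1) :
    (lambdaGraph (DBrace G)).HasExactlyOneVertex := by
  have := finite_of_odd_card hG
  have : Nontrivial G := by
    rw [← Finite.one_lt_card_iff_nontrivial]
    exact lt_of_le_of_ne hG.pos h1.symm
  exact (isSplitDihedral hG).hasExactlyOneVertex

theorem nonempty_iso_iff (hG : Odd (Nat.card G)) (hG' : Odd (Nat.card G')) :
    Nonempty (SkewBraceIso (DBrace G) (DBrace G')) ↔ Nonempty (G ≃+ G') := by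
  have := finite_of_odd_card hG
  have := finite_of_odd_card hG'
  exact (isSplitDihedral hG).nonempty_ringEquiv_iff (isSplitDihedral hG')
    (card_zmod_two_pow_coprime hG) (card_zmod_two_pow_coprime hG')

end DBrace

namespace JBrace

theorem nat_card (i : ℕ) (hG : Odd (Nat.card G)) :
    Nat.card (JBrace i G) = 2 ^ (i + 1) * Nat.card G := by
  have := finite_of_odd_card hG
  rw [(isSplitDihedral i hG).nat_card, Nat.card_zmod, pow_succ', mul_assoc]

theorem hasExactlyOneVertex (hi : i ≠ 0) (hG : Odd (Nat.card G)) :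
    (lambdaGraph (JBrace i G)).HasExactlyOneVertex := by
  have := finite_of_odd_card hG
  have := zmod_two_pow_nontrivial hi
  exact (isSplitDihedral i hG).hasExactlyOneVertex

theorem nonempty_iso_iff (i : ℕ) (hG : Odd (Nat.card G)) (hG' : Odd (Nat.card G')) :
    Nonempty (SkewBraceIso (JBrace i G) (JBrace i G')) ↔ Nonempty (G ≃+ G') := by
  have := finite_of_odd_card hG
  have := finite_of_odd_card hG'
  exact (isSplitDihedral i hG).nonempty_ringEquiv_iff (isSplitDihedral i hG')
    (card_zmod_two_pow_coprime hG) (card_zmod_two_pow_coprime hG')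

end JBrace

namespace HBrace

theorem nat_card (i : ℕ) (hG : Odd (Nat.card G)) :
    Nat.card (HBrace i G) = 2 ^ (i + 1) * Nat.card G := by
  have := finite_of_odd_card hG
  rw [(isSplitDihedral i hG).nat_card, Nat.card_zmod, pow_succ', mul_assoc]

theorem hasExactlyOneVertex (hi : i ≠ 0) (hG : Odd (Nat.card G)) :
    (lambdaGraph (HBrace i G)).HasExactlyOneVertex := by
  have := finite_of_odd_card hG
  have := zmod_two_pow_nontrivial hi
  exact (isSplitDihedral i hG).hasExactlyOneVertex

theorem nonempty_iso_iff (i : ℕ) (hG : Odd (Nat.card G)) (hG' : Odd (Nat.card G')) :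
    Nonempty (SkewBraceIso (HBrace i G) (HBrace i G')) ↔ Nonempty (G ≃+ G') := by
  have := finite_of_odd_card hG
  have := finite_of_odd_card hG'
  exact (isSplitDihedral i hG).nonempty_ringEquiv_iff (isSplitDihedral i hG')
    (card_zmod_two_pow_coprime hG) (card_zmod_two_pow_coprime hG')

end HBrace

namespace KBrace

theorem nat_card (hG : Odd (Nat.card G)) : Nat.card (KBrace G) = 2 ^ 3 * Nat.card G := by
  have := finite_of_odd_card hG
  rw [(isSplitDihedral hG).nat_card, Nat.card_prod, Nat.card_zmod]
  ring

theorem hasExactlyOneVertex (hG : Odd (Nat.card G)) :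
    (lambdaGraph (KBrace G)).HasExactlyOneVertex := by
  have := finite_of_odd_card hG
  exact (isSplitDihedral hG).hasExactlyOneVertex

theorem nonempty_iso_iff (hG : Odd (Nat.card G)) (hG' : Odd (Nat.card G')) :
    Nonempty (SkewBraceIso (KBrace G) (KBrace G')) ↔ Nonempty (G ≃+ G') := by
  have := finite_of_odd_card hG
  have := finite_of_odd_card hG'
  exact (isSplitDihedral hG).nonempty_ringEquiv_iff (isSplitDihedral hG')
    (card_klein_coprime hG) (card_klein_coprime hG')

end KBrace

theorem zmod_two_pow_pred_ne_zero (hi : i ≠ 0) : (2 ^ (i - 1) : ZMod (2 ^ i)) ≠ 0 := by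
  intro h
  have hdvd : 2 ^ i ∣ 2 ^ (i - 1) := by
    rw [← ZMod.natCast_eq_zero_iff]
    exact_mod_cast h
  have := (Nat.pow_dvd_pow_iff_le_right one_lt_two).1 hdvd
  omega

theorem JBrace.isEmpty_iso_hBrace (hi : i ≠ 0) (hG : Odd (Nat.card G)) (hG' : Odd (Nat.card G')) :
    IsEmpty (SkewBraceIso (JBrace i G) (HBrace i G')) := by
  have := zmod_two_pow_nontrivial hi
  refine ⟨fun E => ?_⟩
  obtain ⟨-, e, -, he⟩ := (isSplitDihedral i hG).exists_addEquiv (HBrace.isSplitDihedral i hG')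
    (card_zmod_two_pow_coprime hG') (card_zmod_two_pow_coprime hG).symm E
  exact zmod_two_pow_pred_ne_zero hi (he.symm.trans (map_zero e))

theorem KBrace.isEmpty_iso_of_isSplitDihedral_negTwo {A P : Type*} [SkewBrace A] [AddCommGroup P]
    [Nontrivial P] {c z : P} (h : IsSplitDihedral (negTwo P) c z G' A)
    (hP : (Nat.card P).Coprime (Nat.card G)) (hG : Odd (Nat.card G)) (hG' : Odd (Nat.card G')) :
    IsEmpty (KBrace G ≃+* A) := by
  refine ⟨fun E => ?_⟩
  obtain ⟨-, e, he, rfl⟩ := (isSplitDihedral hG).exists_addEquiv h (card_klein_coprime hG')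
    hP.symm E
  have hz : e (kleinShift (0, 1)) = e (negTwo _ (0, 1)) := (he _).trans (map_zsmul e _ _).symm
  exact absurd (e.injective hz) (by decide)

theorem KBrace.isEmpty_iso_jBrace (hi : i ≠ 0) (hG : Odd (Nat.card G)) (hG' : Odd (Nat.card G')) :
    IsEmpty (SkewBraceIso (KBrace G) (JBrace i G')) := by
  have := zmod_two_pow_nontrivial hi
  exact isEmpty_iso_of_isSplitDihedral_negTwo (JBrace.isSplitDihedral i hG')
    (card_zmod_two_pow_coprime hG) hG hG'

theorem KBrace.isEmpty_iso_hBrace (hi : i ≠ 0) (hG : Odd (Nat.card G)) (hG' : Odd (Nat.card G')) :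
    IsEmpty (SkewBraceIso (KBrace G) (HBrace i G')) := by
  have := zmod_two_pow_nontrivial hi
  exact isEmpty_iso_of_isSplitDihedral_negTwo (HBrace.isSplitDihedral i hG')
    (card_zmod_two_pow_coprime hG) hG hG'

end Families

section Classification

namespace IsSplitDihedral

variable {P G A : Type*} [AddCommGroup P] [AddCommGroup G] [SkewBrace A] {ψ : P →+ P} {c z : P}

theorem exists_zmod (h : IsSplitDihedral ψ c z G A) (hz : ψ z = 0) {i : ℕ}
    (hP : Nat.card P = 2 ^ i) :
    ∃ z' : ZMod (2 ^ i), 2 • z' = 0 ∧ IsSplitDihedral (negTwo (ZMod (2 ^ i))) 1 z' G A := by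
  have hdatum := h.isDihedralDatum
  obtain ⟨e, he⟩ := exists_zmod_addEquiv_of_zmultiples_eq_top hP (hdatum.zmultiples_eq_top hz hP)
  obtain rfl := hdatum.eq_negTwo hz
  have h' := h.congr e (.refl G) (ψ' := negTwo _) (fun x => map_zsmul e _ _) he
    (e.apply_symm_apply z)
  exact ⟨_, h'.isDihedralDatum.two_nsmul_eq_zero, h'⟩

theorem klein (h : IsSplitDihedral ψ c z G A) (hz : ψ z ≠ 0) {i : ℕ} (hP : Nat.card P = 2 ^ i) :
    i = 2 ∧ IsSplitDihedral kleinShift (0, 1) (0, 1) G A := by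
  obtain ⟨x, hx⟩ := h.isDihedralDatum.exists_eq_add_map hz
  have h : IsSplitDihedral ψ z z G A := by simpa [← hx] using h.shift (-x)
  obtain ⟨e, hψ, he⟩ := h.isDihedralDatum.exists_klein_addEquiv hz hP
  refine ⟨Nat.pow_right_injective le_rfl ?_, h.congr e (.refl G) hψ he he⟩
  change 2 ^ i = 2 ^ 2
  rw [← hP, ← Nat.card_congr e.toEquiv, Nat.card_prod, Nat.card_zmod]

end IsSplitDihedral

theorem exists_iso_of_hasExactlyOneVertex {A : Type u} [SkewBrace A] [Finite A] {m d : ℕ}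
    (hd : Odd d) (hA : Nat.card A = 2 ^ m * d) (hΛ : (lambdaGraph A).HasExactlyOneVertex) :
    m ≠ 0 ∧ ∃ (G : Type u) (_ : AddCommGroup G), Nat.card G = d ∧
      ((m = 1 ∧ d ≠ 1 ∧ Nonempty (SkewBraceIso A (DBrace G))) ∨
        (2 ≤ m ∧ Nonempty (SkewBraceIso A (JBrace (m - 1) G))) ∨
        (2 ≤ m ∧ Nonempty (SkewBraceIso A (HBrace (m - 1) G))) ∨
        (m = 3 ∧ Nonempty (SkewBraceIso A (KBrace G)))) := by
  obtain ⟨i, rfl, P, G, _, _, ψ, c, z, hP, rfl, _, h⟩ := exists_isSplitDihedral hd hA hΛ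
  refine ⟨i.succ_ne_zero, G, inferInstance, rfl, ?_⟩
  by_cases hz : ψ z = 0
  · obtain ⟨z', hz', h⟩ := h.exists_zmod hz hP
    obtain _ | i := i
    · have hG : Nat.card G ≠ 1 := fun hG => by
        have hPG : Nat.card (P × G) = 1 := by rw [Nat.card_prod, hP, hG, pow_zero, one_mul]
        exact not_subsingleton (P × G) (Nat.card_eq_one_iff_unique.1 hPG).1
      obtain rfl : z' = 0 := Subsingleton.elim (α := ZMod 1) _ _
      exact Or.inl ⟨rfl, hG, h.nonempty_ringEquiv (DBrace.isSplitDihedral hd) (.refl G)⟩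
    · have hm : 2 ≤ i + 1 + 1 := Nat.le_add_left 2 i
      obtain rfl | rfl := zmod_eq_zero_or_eq_of_two_nsmul_eq_zero hz'
      · exact Or.inr (Or.inl
          ⟨hm, h.nonempty_ringEquiv (JBrace.isSplitDihedral _ hd) (.refl G)⟩)
      · exact Or.inr (Or.inr (Or.inl
          ⟨hm, h.nonempty_ringEquiv (HBrace.isSplitDihedral _ hd) (.refl G)⟩))
  · obtain ⟨rfl, h⟩ := h.klein hz hP
    exact Or.inr (Or.inr (Or.inr
      ⟨rfl, h.nonempty_ringEquiv (KBrace.isSplitDihedral hd) (.refl G)⟩))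

end Classification

section Counting

variable {i d n : ℕ}

theorem numOneVertexSkewBraces_eq_card_mul {κ : Type*} [LinearOrder κ]
    (Φ : κ → AbelianGroupOfOrder.{u} d → OneVertexSkewBrace.{u} n)
    (hiso : ∀ j X Y, Nonempty (SkewBraceIso (Φ j X).carrier (Φ j Y).carrier) ↔
      Nonempty (X.carrier ≃+ Y.carrier))
    (hne : ∀ j k X Y, j < k → IsEmpty (SkewBraceIso (Φ j X).carrier (Φ k Y).carrier))
    (hsurj : ∀ B : OneVertexSkewBrace.{u} n, ∃ j X,
      Nonempty (SkewBraceIso B.carrier (Φ j X).carrier)) :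
    numOneVertexSkewBraces.{u} n = Nat.card κ * numAbelianGroups.{u} d := by
  rw [numAbelianGroups, ← Nat.card_prod, numOneVertexSkewBraces]
  let f : κ × Quotient (AbelianGroupOfOrder.isoSetoid.{u} d) →
      Quotient (OneVertexSkewBrace.isoSetoid.{u} n) := fun p =>
    Quotient.map' (Φ p.1) (fun X Y => (hiso p.1 X Y).2) p.2
  refine (Nat.card_congr (Equiv.ofBijective f ⟨?_, ?_⟩)).symm
  · rintro ⟨j, ⟨X⟩⟩ ⟨k, ⟨Y⟩⟩ h
    obtain ⟨E⟩ : Nonempty (SkewBraceIso (Φ j X).carrier (Φ k Y).carrier) := Quotient.exact h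
    obtain hjk | rfl | hkj := lt_trichotomy j k
    · exact ((hne j k X Y hjk).false E).elim
    · exact Prod.ext rfl (Quotient.sound ((hiso j X Y).1 ⟨E⟩))
    · exact ((hne k j Y X hkj).false E.symm).elim
  · rintro ⟨B⟩
    obtain ⟨j, X, h⟩ := hsurj B
    exact ⟨(j, ⟦X⟧), (Quotient.sound h).symm⟩

/-- A skew brace of nonzero size `n` with one-vertex `λ`-graph as a term of the structure counted
by `numOneVertexSkewBraces`. -/
def OneVertexSkewBrace.of {A : Type u} [SkewBrace A] (hn : n ≠ 0) (hA : Nat.card A = n)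
    (hΛ : (lambdaGraph A).HasExactlyOneVertex) : OneVertexSkewBrace.{u} n where
  carrier := A
  finite := Nat.finite_of_card_ne_zero (hA ▸ hn)
  card_eq := hA
  oneVertex := hΛ

namespace AbelianGroupOfOrder

theorem odd_card (X : AbelianGroupOfOrder.{u} d) (hd : Odd d) : Odd (Nat.card X.carrier) :=
  X.card_eq.symm ▸ hd

/-- The skew brace `D_{2d}(G)`. -/
def dBrace (hd : Odd d) (h1 : d ≠ 1) (X : AbelianGroupOfOrder.{u} d) :
    OneVertexSkewBrace.{u} (2 * d) :=
  .of (mul_ne_zero two_ne_zero hd.pos.ne')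
    ((DBrace.nat_card (X.odd_card hd)).trans (by rw [X.card_eq]))
    (DBrace.hasExactlyOneVertex (X.odd_card hd) (X.card_eq.symm ▸ h1))

/-- The skew brace `J_{2^(i+1)d}(G)`. -/
def jBrace (hi : i ≠ 0) (hd : Odd d) (X : AbelianGroupOfOrder.{u} d) :
    OneVertexSkewBrace.{u} (2 ^ (i + 1) * d) :=
  .of (mul_ne_zero (by simp) hd.pos.ne')
    ((JBrace.nat_card i (X.odd_card hd)).trans (by rw [X.card_eq]))
    (JBrace.hasExactlyOneVertex hi (X.odd_card hd))

/-- The skew brace `H_{2^(i+1)d}(G)`. -/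
def hBrace (hi : i ≠ 0) (hd : Odd d) (X : AbelianGroupOfOrder.{u} d) :
    OneVertexSkewBrace.{u} (2 ^ (i + 1) * d) :=
  .of (mul_ne_zero (by simp) hd.pos.ne')
    ((HBrace.nat_card i (X.odd_card hd)).trans (by rw [X.card_eq]))
    (HBrace.hasExactlyOneVertex hi (X.odd_card hd))

/-- The skew brace `K_{8d}(G)`. -/
def kBrace (hd : Odd d) (X : AbelianGroupOfOrder.{u} d) :
    OneVertexSkewBrace.{u} (2 ^ 3 * d) :=
  .of (mul_ne_zero (by simp) hd.pos.ne')
    ((KBrace.nat_card (X.odd_card hd)).trans (by rw [X.card_eq]))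
    (KBrace.hasExactlyOneVertex (X.odd_card hd))

end AbelianGroupOfOrder

open AbelianGroupOfOrder

theorem numOneVertexSkewBraces_of_odd (hd : Odd d) : numOneVertexSkewBraces.{u} d = 0 := by
  have : IsEmpty (Quotient (OneVertexSkewBrace.isoSetoid.{u} d)) := by
    refine ⟨?_⟩
    rintro ⟨B⟩
    have hB : Nat.card B.carrier = 2 ^ 0 * d := by rw [B.card_eq, pow_zero, one_mul]
    exact (exists_iso_of_hasExactlyOneVertex hd hB B.oneVertex).1 rfl
  exact Nat.card_of_isEmpty

theorem numOneVertexSkewBraces_two : numOneVertexSkewBraces.{u} 2 = 0 := by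
  have : IsEmpty (Quotient (OneVertexSkewBrace.isoSetoid.{u} 2)) := by
    refine ⟨?_⟩
    rintro ⟨B⟩
    have hB : Nat.card B.carrier = 2 ^ 1 * 1 := B.card_eq
    obtain ⟨-, _, _, -, h⟩ := exists_iso_of_hasExactlyOneVertex odd_one hB B.oneVertex
    simp at h
  exact Nat.card_of_isEmpty

theorem numOneVertexSkewBraces_two_mul (hd : Odd d) (h1 : d ≠ 1) :
    numOneVertexSkewBraces.{u} (2 * d) = numAbelianGroups.{u} d := by
  rw [numOneVertexSkewBraces_eq_card_mul (fun _ : Unit => dBrace hd h1)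
    (fun _ X Y => DBrace.nonempty_iso_iff (X.odd_card hd) (Y.odd_card hd))
    (fun _ _ _ _ h => (lt_irrefl _ h).elim) ?_, Nat.card_unique, one_mul]
  intro B
  have hB : Nat.card B.carrier = 2 ^ 1 * d := B.card_eq
  obtain ⟨-, G, _, hG, ⟨-, -, h⟩ | ⟨h, -⟩ | ⟨h, -⟩ | ⟨h, -⟩⟩ :=
    exists_iso_of_hasExactlyOneVertex hd hB B.oneVertex
  · exact ⟨(), ⟨G, hG⟩, h⟩
  all_goals omega

theorem numOneVertexSkewBraces_two_pow_mul (hi : i ≠ 0) (hi2 : i ≠ 2) (hd : Odd d) :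
    numOneVertexSkewBraces.{u} (2 ^ (i + 1) * d) = 2 * numAbelianGroups.{u} d := by
  rw [numOneVertexSkewBraces_eq_card_mul ![jBrace hi hd, hBrace hi hd] ?_ ?_ ?_, Nat.card_fin]
  · refine Fin.forall_fin_two.2 ⟨fun X Y => ?_, fun X Y => ?_⟩
    · exact JBrace.nonempty_iso_iff i (X.odd_card hd) (Y.odd_card hd)
    · exact HBrace.nonempty_iso_iff i (X.odd_card hd) (Y.odd_card hd)
  · intro j k X Y hjk
    obtain ⟨rfl, rfl⟩ : j = 0 ∧ k = 1 := by revert j k; decide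
    exact JBrace.isEmpty_iso_hBrace hi (X.odd_card hd) (Y.odd_card hd)
  · intro B
    obtain ⟨-, G, _, hG, ⟨h, -⟩ | ⟨-, h⟩ | ⟨-, h⟩ | ⟨h, -⟩⟩ :=
      exists_iso_of_hasExactlyOneVertex hd B.card_eq B.oneVertex
    · omega
    · exact ⟨0, ⟨G, hG⟩, h⟩
    · exact ⟨1, ⟨G, hG⟩, h⟩
    · omega

theorem numOneVertexSkewBraces_eight_mul (hd : Odd d) :
    numOneVertexSkewBraces.{u} (2 ^ 3 * d) = 3 * numAbelianGroups.{u} d := by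
  have hi : 2 ≠ 0 := two_ne_zero
  rw [numOneVertexSkewBraces_eq_card_mul ![kBrace hd, jBrace hi hd, hBrace hi hd] ?_ ?_ ?_,
    Nat.card_fin]
  · intro j X Y
    fin_cases j
    · exact KBrace.nonempty_iso_iff (X.odd_card hd) (Y.odd_card hd)
    · exact JBrace.nonempty_iso_iff 2 (X.odd_card hd) (Y.odd_card hd)
    · exact HBrace.nonempty_iso_iff 2 (X.odd_card hd) (Y.odd_card hd)
  · intro j k X Y hjk
    obtain ⟨rfl, rfl⟩ | ⟨rfl, rfl⟩ | ⟨rfl, rfl⟩ :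
        (j = 0 ∧ k = 1) ∨ (j = 0 ∧ k = 2) ∨ (j = 1 ∧ k = 2) := by
      revert j k; decide
    · exact KBrace.isEmpty_iso_jBrace hi (X.odd_card hd) (Y.odd_card hd)
    · exact KBrace.isEmpty_iso_hBrace hi (X.odd_card hd) (Y.odd_card hd)
    · exact JBrace.isEmpty_iso_hBrace hi (X.odd_card hd) (Y.odd_card hd)
  · intro B
    obtain ⟨-, G, _, hG, ⟨h, -⟩ | ⟨-, h⟩ | ⟨-, h⟩ | ⟨-, h⟩⟩ :=
      exists_iso_of_hasExactlyOneVertex hd B.card_eq B.oneVertex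
    · omega
    · exact ⟨1, ⟨G, hG⟩, h⟩
    · exact ⟨2, ⟨G, hG⟩, h⟩
    · exact ⟨0, ⟨G, hG⟩, h⟩

end Counting

end Development

theorem mainTheorem1 (m d : ℕ) (hd : Odd d) :
    -- the listed skew braces have size `2 ^ m * d` and one-vertex `λ`-graph
    (∀ (G : Type u) [AddCommGroup G], Nat.card G = d →
      (m = 1 → d ≠ 1 →
        Nat.card (DBrace G) = 2 ^ m * d ∧ (lambdaGraph (DBrace G)).HasExactlyOneVertex) ∧
      (2 ≤ m →
        Nat.card (JBrace (m - 1) G) = 2 ^ m * d ∧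
          (lambdaGraph (JBrace (m - 1) G)).HasExactlyOneVertex) ∧
      (2 ≤ m →
        Nat.card (HBrace (m - 1) G) = 2 ^ m * d ∧
          (lambdaGraph (HBrace (m - 1) G)).HasExactlyOneVertex) ∧
      (m = 3 →
        Nat.card (KBrace G) = 2 ^ m * d ∧ (lambdaGraph (KBrace G)).HasExactlyOneVertex)) ∧
    -- the list is complete
    (∀ (A : Type u) [SkewBrace A] [Finite A], Nat.card A = 2 ^ m * d →
      (lambdaGraph A).HasExactlyOneVertex →
      m ≠ 0 ∧
      ∃ (G : Type u) (_ : AddCommGroup G), Nat.card G = d ∧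
        ((m = 1 ∧ d ≠ 1 ∧ Nonempty (SkewBraceIso A (DBrace G))) ∨
          (2 ≤ m ∧ Nonempty (SkewBraceIso A (JBrace (m - 1) G))) ∨
          (2 ≤ m ∧ Nonempty (SkewBraceIso A (HBrace (m - 1) G))) ∨
          (m = 3 ∧ Nonempty (SkewBraceIso A (KBrace G))))) ∧
    -- the list has no repetitions up to isomorphism
    (∀ (G G' : Type u) [AddCommGroup G] [AddCommGroup G'], Nat.card G = d → Nat.card G' = d →
      (m = 1 → (Nonempty (SkewBraceIso (DBrace G) (DBrace G')) ↔ Nonempty (G ≃+ G'))) ∧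
      (2 ≤ m →
        (Nonempty (SkewBraceIso (JBrace (m - 1) G) (JBrace (m - 1) G')) ↔ Nonempty (G ≃+ G')) ∧
        (Nonempty (SkewBraceIso (HBrace (m - 1) G) (HBrace (m - 1) G')) ↔ Nonempty (G ≃+ G')) ∧
        IsEmpty (SkewBraceIso (JBrace (m - 1) G) (HBrace (m - 1) G'))) ∧
      (m = 3 →
        (Nonempty (SkewBraceIso (KBrace G) (KBrace G')) ↔ Nonempty (G ≃+ G')) ∧
        IsEmpty (SkewBraceIso (KBrace G) (JBrace (m - 1) G')) ∧
        IsEmpty (SkewBraceIso (KBrace G) (HBrace (m - 1) G')))) ∧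
    -- the number of isomorphism classes
    (m = 0 → numOneVertexSkewBraces.{u} (2 ^ m * d) = 0) ∧
    (m = 1 → d = 1 → numOneVertexSkewBraces.{u} (2 ^ m * d) = 0) ∧
    (m = 1 → d ≠ 1 → numOneVertexSkewBraces.{u} (2 ^ m * d) = numAbelianGroups.{u} d) ∧
    (m = 2 → numOneVertexSkewBraces.{u} (2 ^ m * d) = 2 * numAbelianGroups.{u} d) ∧
    (m = 3 → numOneVertexSkewBraces.{u} (2 ^ m * d) = 3 * numAbelianGroups.{u} d) ∧
    (4 ≤ m → numOneVertexSkewBraces.{u} (2 ^ m * d) = 2 * numAbelianGroups.{u} d) := by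
  refine ⟨?listed, fun A _ _ => exists_iso_of_hasExactlyOneVertex hd, ?irredundant,
    by rintro rfl; simpa using numOneVertexSkewBraces_of_odd hd,
    by rintro rfl rfl; exact numOneVertexSkewBraces_two,
    by rintro rfl h1; exact numOneVertexSkewBraces_two_mul hd h1,
    by rintro rfl; exact numOneVertexSkewBraces_two_pow_mul one_ne_zero (by decide) hd,
    by rintro rfl; exact numOneVertexSkewBraces_eight_mul hd, fun hm => ?_⟩
  case listed =>
    rintro G _ rfl
    refine ⟨?_, fun hm => ?_, fun hm => ?_, ?_⟩
    · rintro rfl h1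
      exact ⟨DBrace.nat_card hd, DBrace.hasExactlyOneVertex hd h1⟩
    · obtain ⟨i, rfl⟩ := Nat.exists_eq_add_of_le' hm
      exact ⟨JBrace.nat_card _ hd, JBrace.hasExactlyOneVertex i.succ_ne_zero hd⟩
    · obtain ⟨i, rfl⟩ := Nat.exists_eq_add_of_le' hm
      exact ⟨HBrace.nat_card _ hd, HBrace.hasExactlyOneVertex i.succ_ne_zero hd⟩
    · rintro rfl
      exact ⟨KBrace.nat_card hd, KBrace.hasExactlyOneVertex hd⟩
  case irredundant =>
    rintro G G' _ _ rfl hG'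
    have hd' : Odd (Nat.card G') := hG'.symm ▸ hd
    exact ⟨fun _ => DBrace.nonempty_iso_iff hd hd', fun hm => ⟨JBrace.nonempty_iso_iff _ hd hd',
      HBrace.nonempty_iso_iff _ hd hd', JBrace.isEmpty_iso_hBrace (by omega) hd hd'⟩,
      fun hm => ⟨KBrace.nonempty_iso_iff hd hd', KBrace.isEmpty_iso_jBrace (by omega) hd hd',
        KBrace.isEmpty_iso_hBrace (by omega) hd hd'⟩⟩
  obtain ⟨i, rfl⟩ := Nat.exists_eq_add_of_le' hm
  exact numOneVertexSkewBraces_two_pow_mul (by omega) (by omega) hd
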